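/- **Theorem (renormalization group equation for $g^{\mathrm{comb}}$).** Let $R$ be a commutative binomial ring (for instance $\mathbb Z$ or any commutative $\mathbb Q$-algebra, such as $\mathbb R$ or $\mathbb C$), let $s\in R$, let $\mathcal D\subseteq\{1,2,3,\dots\}$ be a set of decorations, and let $a_{d,i}\in R$ for $d\ge 1$, $i\ge 0$. *Chord diagrams.* A rooted chord diagram of size $n$ is a fixed-point-free involution of $\{1,\dots,2n\}$, i.e. a set of chords $(x_1\,y_1)\cdots(x_n\,y_n)$ with $x_1<\dots<x_n$ and $x_i<y_i$; $(x_1\,y_1)$ is the root chord. Chords $(x\,y)$, $(x'\,y')$ cross if $x<x'<y<y'$ or $x'<x<y'<y$. The diagram is connected if its graph of crossings is connected (and nonempty). A chord is terminal if it crosses no chord with a larger first endpoint. $\mathcal R^{\mathrm{dec}}$ is the set of rooted connected chord diagrams with every chord decorated by an element of $\mathcal D$. Chords are labeled $1,\dots,|C|$ in intersection order: the root chord comes first, then, recursively, the connected components of what is left after its removal, traversed counterclockwise (by increasing position of their first endpoints). Let $d_c$ be the decoration of the chord labeled $c$, let $\|C\|=\sum_c d_c$, let $\mathrm{ter}(C)=\{t_0<t_1<\dots<t_m\}$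 be the labels of the terminal chords, $b(C)=t_0$, and $$\hat a_C=\prod_{j=1}^{m}a_{d_{t_j},\,t_j-t_{j-1}}\prod_{c\notin \mathrm{ter}(C)}a_{d_c,0}.$$ *Insertion tree and weight.* For diagrams $C'$ of size $n$ and $C''$ of size $m$ and $1\le k\le 2m-1$, the diagram $C'\circ_kC''$ of size $n+m$ has the chords $(1\;\,y+k)$ for the root chord $(1\,y)$ of $C'$, $(x+k\;\,y+k)$ for the other chords $(x\,y)$ of $C'$, and $(H(x)\,H(y))$ for the chords $(x\,y)$ of $C''$, where $H(x)=x+1$ if $x\le k$ and $H(x)=x+2n$ otherwise. Every connected $C$ with $|C|>1$ can be written uniquely as $C=C'\circ_kC''$, where $C''$ is (after renumbering endpoints) the first connected component of $C$ minus its root chord, and $C'$ is the rest. The plane binary tree $T(C)$, with the chords of $C$ as leaves, is a single vertex if $|C|=1$ and otherwise $T(C')\circ_kT(C'')$: number the edges of $T(C'')$ in pre-order, with number $1$ for a virtual edge above the root, put a new vertex on edge $k$, and give it $T(C')$ as left subtree and the part of $T(C'')$ below edge $k$ as right subtree. Let $\nu_c$ be the number of edges of the path from leaf $c$ that moves up and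 to the left as long as possible, and $$\omega_C=\prod_{c=1}^{|C|}\binom{d_c\,s+\nu_c-2}{\nu_c}$$ (generalized binomial coefficients). For $k\ge 1$ define the formal power series $$g_k^{\mathrm{comb}}(x)=\sum_{\substack{C\in\mathcal R^{\mathrm{dec}}\\ b(C)\ge k}}x^{\|C\|}\,\omega_C\,\hat a_C\,a_{d_{b(C)},\,b(C)-k}\in R[[x]].$$ Then for every $k\ge 2$ $$g_k^{\mathrm{comb}}(x)=g_1^{\mathrm{comb}}(x)\cdot\Bigl(s\,x\frac{\partial}{\partial x}-1\Bigr)g_{k-1}^{\mathrm{comb}}(x).$$ -/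

import Mathlib

namespace ChordDSE

/-! ### Chords and sets of chords -/

/-- A chord `(x y)` with `x < y`, recorded as a pair of natural numbers. The lexicographic order
compares chords with distinct left endpoints by their left endpoints. -/
abbrev Chord : Type := ℕ ×ₗ ℕ

/-- The first endpoint of a chord. -/
def Chord.left (c : Chord) : ℕ := (ofLex c).1

/-- The second endpoint of a chord. -/
def Chord.right (c : Chord) : ℕ := (ofLex c).2

/-- The chord with first endpoint `x` and second endpoint `y`. -/
def mkChord (x y : ℕ) : Chord := toLex (x, y)

/-- Two chords cross. -/
def Crosses (c c' : Chord) : Prop :=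
  (c.left < c'.left ∧ c'.left < c.right ∧ c.right < c'.right) ∨
    (c'.left < c.left ∧ c.left < c'.right ∧ c'.right < c.right)

instance : DecidableRel Crosses := fun c c' => by unfold Crosses; infer_instance

/-- The intersection graph of a set of chords. -/
def intersectionGraph (S : Finset Chord) : SimpleGraph S where
  Adj c c' := Crosses c c'
  symm := ⟨fun _ _ h => Or.symm h⟩
  loopless := ⟨fun _ h => by
    rcases h with h | h <;> exact absurd h.1 (lt_irrefl _)⟩

instance (S : Finset Chord) : DecidableRel (intersectionGraph S).Adj :=
  fun c c' => inferInstanceAs (Decidable (Crosses c c'))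

/-- The connected component of the chord `c` in a set of chords `S` (empty if `c ∉ S`). -/
def component (S : Finset Chord) (c : Chord) : Finset Chord :=
  S.filter fun c' => ∃ (h : c ∈ S) (h' : c' ∈ S),
    (intersectionGraph S).Reachable ⟨c, h⟩ ⟨c', h'⟩

/-- The root chord of a nonempty set of chords: the one with the smallest first endpoint. -/
def root (S : Finset Chord) : Chord :=
  if h : S.Nonempty then S.min' h else mkChord 0 0

theorem root_mem {S : Finset Chord} (h : S ≠ ∅) : root S ∈ S := by
  have h' : S.Nonempty := Finset.nonempty_iff_ne_empty.2 h
  rw [root, dif_pos h']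
  exact S.min'_mem h'

theorem component_subset (S : Finset Chord) (c : Chord) : component S c ⊆ S :=
  Finset.filter_subset _ _

theorem mem_component_self {S : Finset Chord} {c : Chord} (h : c ∈ S) : c ∈ component S c :=
  Finset.mem_filter.2 ⟨h, h, h, SimpleGraph.Reachable.refl _⟩

/-! ### The intersection order -/

/-- The chords of `S`, listed in intersection order. The connected components of `S` are traversed
counterclockwise, that is, by increasing position of their root chords; in each component the root
chord comes first, followed by the components of what is left after removing it, traversed in the
same manner. -/
def intersectionOrder (S : Finset Chord) : List Chord :=
  if _h : S = ∅ then [] else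
    root S :: (intersectionOrder ((component S (root S)).erase (root S)) ++
      intersectionOrder (S \ component S (root S)))
termination_by S.card
decreasing_by
  · have hr := mem_component_self (root_mem _h)
    exact lt_of_lt_of_le (Finset.card_erase_lt_of_mem hr)
      (Finset.card_le_card (component_subset _ _))
  · exact Finset.card_lt_card (Finset.sdiff_ssubset (component_subset _ _)
      ⟨_, mem_component_self (root_mem _h)⟩)

/-! ### Insertion of chord diagrams and the root share decomposition -/

/-- The set of endpoints of the chords in `S`. -/
def endpoints (S : Finset Chord) : Finset ℕ := S.image Chord.left ∪ S.image Chord.right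

/-- Normalization: the endpoints `a₁ < a₂ < ⋯` of the chords in `S` are renamed `1, 2, …`. -/
def norm (S : Finset Chord) : Finset Chord :=
  S.image fun c => mkChord ((endpoints S).filter (· ≤ c.left)).card
    ((endpoints S).filter (· ≤ c.right)).card

/-- The shift `H_{n,k}`. -/
def shift (n k x : ℕ) : ℕ := if x ≤ k then x + 1 else x + 2 * n

/-- The insertion `C ∘ₖ D` of chord diagrams: the root chord `(1 y₁)` of `C` becomes
`(1 y₁+k)`, the other chords `(x y)` of `C` become `(x+k y+k)`, and the endpoints of the chords of
`D` are moved by `H_{|C|,k}`. -/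
def insertion (C : Finset Chord) (k : ℕ) (D : Finset Chord) : Finset Chord :=
  (C.image fun c => mkChord (if c.left = 1 then 1 else c.left + k) (c.right + k)) ∪
    D.image fun c => mkChord (shift C.card k c.left) (shift C.card k c.right)

/-- For a connected set `S` of at least two chords: the first connected component of what is left
of `S` after its root chord is removed. -/
def firstComponent (S : Finset Chord) : Finset Chord :=
  component (S.erase (root S)) (root (S.erase (root S)))

/-- The position `k` in the root share decomposition
`S = norm (S \ S₁) ∘ₖ norm S₁`, where `S₁ = firstComponent S`. For a connected `S` with at least
two chords exactly one `k` qualifies, and `sup` picks it. -/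
def insertionIndex (S : Finset Chord) : ℕ :=
  ((Finset.Icc 1 (2 * (firstComponent S).card - 1)).filter fun k =>
    norm S = insertion (norm (S \ firstComponent S)) k (norm (firstComponent S))).sup id

/-! ### Insertion trees -/

/-- Rooted plane (full) binary trees with leaves labeled by `α`. -/
inductive PlaneTree (α : Type) : Type
  | leaf (a : α) : PlaneTree α
  | node (l r : PlaneTree α) : PlaneTree α

namespace PlaneTree

variable {α : Type}

/-- The number of edges of the tree, including the virtual edge above its root. -/
def numEdges : PlaneTree α → ℕ
  | leaf _ => 1
  | node l r => 1 + l.numEdges + r.numEdges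

/-- The list of leaf labels, from left to right. -/
def leaves : PlaneTree α → List α
  | leaf a => [a]
  | node l r => l.leaves ++ r.leaves

/-- `insert T k T'` is `T ∘ₖ T'`: the edges of `T'` are numbered in pre-order, starting with `1` for
the virtual edge above the root; a new vertex is put on edge `k`, with `T` as its left subtree and
the part of `T'` below edge `k` as its right subtree. -/
def insert (T : PlaneTree α) : ℕ → PlaneTree α → PlaneTree α
  | _, leaf a => node T (leaf a)
  | k, node l r =>
    if k ≤ 1 then node T (node l r)
    else if k ≤ 1 + l.numEdges then node (insert T (k - 1) l) r
    else node l (insert T (k - 1 - l.numEdges) r)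

/-- Auxiliary function for `branchLeft`; `m` is the number of edges, going up and to the left, that
can be followed in succession from the root of the present subtree. -/
def branchLeftAux [DecidableEq α] (x : α) : ℕ → PlaneTree α → ℕ
  | m, leaf _ => m
  | m, node l r => if x ∈ l.leaves then branchLeftAux x 0 l else branchLeftAux x (m + 1) r

/-- `ν_x`, for the leaf labeled `x` of a tree with distinct leaf labels: the number of edges in the
path that starts at this leaf and moves up and to the left as long as there is such an edge. -/
def branchLeft [DecidableEq α] (T : PlaneTree α) (x : α) : ℕ := branchLeftAux x 0 T

end PlaneTree

theorem firstComponent_nonempty {S : Finset Chord} (h : S.erase (root S) ≠ ∅) :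
    (firstComponent S).Nonempty :=
  ⟨_, mem_component_self (root_mem h)⟩

theorem firstComponent_subset (S : Finset Chord) : firstComponent S ⊆ S.erase (root S) :=
  component_subset _ _

/-- The insertion tree of a connected set of chords. The leaves are labeled by the chords
themselves, so that the trees of the two parts carry the labels that they have in `S`. -/
def insertionTree (S : Finset Chord) : PlaneTree Chord :=
  if _h : S.erase (root S) = ∅ then PlaneTree.leaf (root S) else
    (insertionTree (S \ firstComponent S)).insert (insertionIndex S)
      (insertionTree (firstComponent S))
termination_by S.card
decreasing_by
  · exact Finset.card_lt_card (Finset.sdiff_ssubset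
      ((firstComponent_subset S).trans (Finset.erase_subset _ _)) (firstComponent_nonempty _h))
  · refine lt_of_le_of_lt (Finset.card_le_card (firstComponent_subset S))
      (Finset.card_erase_lt_of_mem (root_mem ?_))
    rintro rfl
    exact _h (Finset.erase_empty _)

/-! ### Rooted chord diagrams -/

/-- A rooted chord diagram of size `n`: a fixed point free involution in `S_{2n}`. -/
abbrev ChordDiagram (n : ℕ) : Type :=
  {σ : Equiv.Perm (Fin (2 * n)) // (∀ i, σ (σ i) = i) ∧ ∀ i, σ i ≠ i}

/-- The set of chords of a rooted chord diagram; the points are numbered `1, …, 2n`. -/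
def ChordDiagram.chords {n : ℕ} (C : ChordDiagram n) : Finset Chord :=
  (Finset.univ.filter fun i : Fin (2 * n) => i < C.1 i).image fun i : Fin (2 * n) =>
    mkChord ((i : ℕ) + 1) ((C.1 i : ℕ) + 1)

/-- The rooted connected chord diagrams with chords decorated by elements of `D`. -/
structure DecDiagram (D : Set ℕ+) : Type where
  /-- the number of chords -/
  size : ℕ
  /-- the underlying rooted chord diagram -/
  diagram : ChordDiagram size
  /-- the intersection graph is connected (so there is at least one chord) -/
  connected : (intersectionGraph diagram.chords).Connected
  /-- the decorations of the chords -/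
  dec : diagram.chords → D

namespace DecDiagram

variable {D : Set ℕ+}

/-- The type of chords of a decorated chord diagram. -/
abbrev Chords (C : DecDiagram D) : Type := C.diagram.chords

/-- The decoration of a chord. -/
def d (C : DecDiagram D) (c : C.Chords) : ℕ+ := C.dec c

/-- The total decoration `‖C‖`. -/
def weightSum (C : DecDiagram D) : ℕ := ∑ c : C.Chords, (C.d c : ℕ)

/-- The label `1, …, |C|` of a chord in the intersection order. -/
def label (C : DecDiagram D) (c : C.Chords) : ℕ :=
  List.idxOf c.1 (intersectionOrder C.diagram.chords) + 1

/-- A chord is terminal if it crosses no chord with a larger first endpoint. -/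
def IsTerminal (C : DecDiagram D) (c : C.Chords) : Prop :=
  ∀ c' : C.Chords, c.1.left < c'.1.left → ¬ Crosses c.1 c'.1

instance (C : DecDiagram D) : DecidablePred C.IsTerminal :=
  fun c => by unfold IsTerminal; infer_instance

/-- The set of terminal chords. -/
def ter (C : DecDiagram D) : Finset C.Chords := Finset.univ.filter C.IsTerminal

theorem ter_nonempty (C : DecDiagram D) : C.ter.Nonempty := by
  have := C.connected.nonempty
  obtain ⟨c, -, hc⟩ := Finset.exists_max_image (Finset.univ : Finset C.Chords)
    (fun c => c.1.left) Finset.univ_nonempty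
  exact ⟨c, Finset.mem_filter.2 ⟨Finset.mem_univ _,
    fun c' h => absurd (hc c' (Finset.mem_univ _)) (not_le.2 h)⟩⟩

/-- The base chord: the terminal chord with the smallest label. -/
noncomputable def base (C : DecDiagram D) : C.Chords :=
  (Finset.exists_min_image C.ter C.label C.ter_nonempty).choose

/-- The label `b(C)` of the base chord. -/
noncomputable def b (C : DecDiagram D) : ℕ := C.label C.base

/-- For a terminal chord `t_j` other than the base chord, the label of the preceding terminal chord
`t_{j-1}`. -/
def prevTerminal (C : DecDiagram D) (c : C.Chords) : ℕ :=
  (C.ter.filter fun c' => C.label c' < C.label c).sup C.label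

/-- The branch-left number `ν_c` of a chord. -/
def nu (C : DecDiagram D) (c : C.Chords) : ℕ :=
  (insertionTree C.diagram.chords).branchLeft c.1

variable {R : Type*} [CommRing R]

/-- The monomial `â_C`: the terminal chords other than the base chord contribute
`a_{d(t_j), t_j - t_{j-1}}`, the chords that are not terminal contribute `a_{d(c), 0}`, and the base
chord does not contribute. -/
noncomputable def aHat (a : ℕ+ → ℕ → R) (C : DecDiagram D) : R :=
  (∏ c ∈ C.ter.erase C.base, a (C.d c) (C.label c - C.prevTerminal c)) *
    ∏ c ∈ C.terᶜ, a (C.d c) 0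

/-- The weight `ω_C`, with generalized binomial coefficients. -/
def omega [BinomialRing R] (s : R) (C : DecDiagram D) : R :=
  ∏ c : C.Chords, Ring.choose ((C.d c : ℕ) * s + (C.nu c : R) - 2) (C.nu c)

end DecDiagram

/-! ### The generating functions -/

theorem card_chords {n : ℕ} (C : ChordDiagram n) : C.chords.card = n := by
  have h1 : C.chords.card = (Finset.univ.filter fun i => i < C.1 i).card := by
    refine Finset.card_image_of_injective _ fun i j h => ?_
    have := congrArg Chord.left h
    simp only [Chord.left, mkChord, ofLex_toLex] at this
    exact Fin.ext (by omega)
  have h2 : (Finset.univ.filter fun i => ¬ i < C.1 i).card =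
      (Finset.univ.filter fun i => i < C.1 i).card := by
    refine Finset.card_bij (fun i _ => C.1 i) ?_ ?_ ?_
    · intro i hi
      simp only [Finset.mem_filter, Finset.mem_univ, true_and] at hi ⊢
      rw [C.2.1]
      exact lt_of_le_of_ne (not_lt.1 hi) (C.2.2 i)
    · intro i _ j _ h
      exact C.1.injective h
    · intro i hi
      simp only [Finset.mem_filter, Finset.mem_univ, true_and] at hi
      refine ⟨C.1 i, ?_, C.2.1 i⟩
      simp only [Finset.mem_filter, Finset.mem_univ, true_and, C.2.1]
      exact not_lt.2 hi.le
  have h3 := Finset.card_filter_add_card_filter_not (s := Finset.univ) (fun i => i < C.1 i)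
  rw [Finset.card_univ, Fintype.card_fin] at h3
  omega

theorem DecDiagram.d_le_weightSum {D : Set ℕ+} (C : DecDiagram D) (c : C.Chords) :
    (C.d c : ℕ) ≤ C.weightSum :=
  Finset.single_le_sum (f := fun c => (C.d c : ℕ)) (fun _ _ => Nat.zero_le _) (Finset.mem_univ c)

theorem DecDiagram.size_le_weightSum {D : Set ℕ+} (C : DecDiagram D) : C.size ≤ C.weightSum := by
  have h := Finset.card_nsmul_le_sum (Finset.univ : Finset C.Chords) (fun c => (C.d c : ℕ)) 1
    (fun c _ => (C.d c).pos)
  rw [Finset.card_univ, Fintype.card_coe, card_chords] at h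
  simpa [DecDiagram.weightSum] using h

/-- There are finitely many decorated chord diagrams of given total decoration, so that the
coefficients of the generating functions below are finite sums. -/
theorem finite_weightSum_eq (D : Set ℕ+) (N : ℕ) : {C : DecDiagram D | C.weightSum = N}.Finite := by
  let f : {C : DecDiagram D | C.weightSum = N} →
      Σ n : Fin (N + 1), Σ C : ChordDiagram n, (C.chords → Fin (N + 1)) := fun C =>
    ⟨⟨C.1.size, Nat.lt_succ_of_le (C.1.size_le_weightSum.trans_eq C.2)⟩, C.1.diagram, fun c =>
      ⟨C.1.d c, Nat.lt_succ_of_le ((C.1.d_le_weightSum c).trans_eq C.2)⟩⟩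
  have hf : Function.Injective f := by
    rintro ⟨⟨n, C, hC, d⟩, h⟩ ⟨⟨n', C', hC', d'⟩, h'⟩ he
    simp only [f, Sigma.mk.injEq, Fin.mk.injEq] at he
    obtain ⟨rfl, he⟩ := he
    obtain ⟨rfl, he⟩ := Sigma.mk.inj (eq_of_heq he)
    have hd : d = d' := by
      funext c
      have := congrFun (eq_of_heq he) c
      exact Subtype.ext (PNat.coe_injective (Fin.mk.inj this))
    subst hd
    rfl
  exact Finite.of_injective f hf

/-- The generating function
`g_k(x) = ∑_{b(C) ≥ k} x^{‖C‖} ω_C â_C a_{d_{b(C)}, b(C) - k}`. -/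
noncomputable def gComb {R : Type*} [CommRing R] [BinomialRing R] (D : Set ℕ+) (s : R)
    (a : ℕ+ → ℕ → R) (k : ℕ) : PowerSeries R :=
  PowerSeries.mk fun N => ∑ᶠ (C : DecDiagram D) (_ : C.weightSum = N ∧ k ≤ C.b),
    C.omega s * C.aHat a * a (C.d C.base) (C.b - k)

end ChordDSE

namespace ChordDSE

/-! The sum is organised by the root share decomposition `C = C' ∘ⱼ C''`. For fixed `C'` and `C''`
the position `j` takes `2|C''| - 1` values, and every connected diagram with more than one chord
arises exactly once (`exists_insertion`, `IsInsertion.parts_unique`). A one-chord diagram has `b(C)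
= 1 < k` and does not contribute. It remains to see how the summand behaves under insertion.

The monomial in the `a`'s does not depend on `j`. The intersection order of `C' ∘ⱼ C''` is the root
of `C'`, then all of `C''`, then the rest of `C'`; the root is not terminal, and all other chords
keep their status. Reading the chords in this order while recording the distance to the last
terminal chord, starting from `1 - k`, gives `gapWeight`, which equals `â_C a_{d, b(C)-k}` if `k ≤
b(C)` and `0` otherwise; so the condition on `b(C)` disappears. The root raises the distance by one,
hence `C''` is read from `1 - (k - 1)` and contributes as in `g_{k-1}`. The last chord of `C''` is
terminal and resets the distance to `1`. Together with the factor of the root, the rest of `C'` then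
gives what `C'` gives when read from `0 = 1 - 1`, as in `g_1` (`Insertable.gapWeight_eq`).

Only `ω` depends on `j`. Each edge of `T(C'')`, the virtual one included, belongs to the chain of
exactly one leaf: its `ν` edges up and to the left and the next edge above them. Insertion at any of
these `ν + 1` edges raises `ν` by one and changes no other branch-left number. As `(ν + 1) χ(ν + 1)
= (d s + ν - 1) χ(ν)` for `χ(ν) = binom(d s + ν - 2, ν)`, the sum over `j` is `ω_{C'} ω_{C''}` times
the sum of `d_c s + ν_c - 1` over the leaves. The `ν_c` add up to the number of right edges, `|C''|
- 1`, so this factor is `s‖C''‖ - 1` (`PlaneTree.sum_weight_insert`), the eigenvalue of `s x d/dx -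
1` on `x^‖C''‖`. -/

theorem Chord.ext_iff {c c' : Chord} : c = c' ↔ c.left = c'.left ∧ c.right = c'.right :=
  ⟨fun h => h ▸ ⟨rfl, rfl⟩, fun h => ofLex.injective (Prod.ext h.1 h.2)⟩

theorem Chord.lt_iff {c c' : Chord} :
    c < c' ↔ c.left < c'.left ∨ c.left = c'.left ∧ c.right < c'.right :=
  Prod.Lex.lt_iff

@[simp] theorem left_mkChord (x y : ℕ) : (mkChord x y).left = x := rfl

@[simp] theorem right_mkChord (x y : ℕ) : (mkChord x y).right = y := rfl

theorem Crosses.symm {c c' : Chord} (h : Crosses c c') : Crosses c' c := Or.symm h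

/-! ### Endpoints and relabelling -/

theorem mem_endpoints {S : Finset Chord} {x : ℕ} :
    x ∈ endpoints S ↔ ∃ c ∈ S, c.left = x ∨ c.right = x := by
  simp only [endpoints, Finset.mem_union, Finset.mem_image]
  constructor
  · rintro (⟨c, h, h'⟩ | ⟨c, h, h'⟩)
    exacts [⟨c, h, .inl h'⟩, ⟨c, h, .inr h'⟩]
  · rintro ⟨c, h, h' | h'⟩
    exacts [.inl ⟨c, h, h'⟩, .inr ⟨c, h, h'⟩]

theorem left_mem_endpoints {S : Finset Chord} {c : Chord} (h : c ∈ S) : c.left ∈ endpoints S :=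
  mem_endpoints.2 ⟨c, h, .inl rfl⟩

theorem right_mem_endpoints {S : Finset Chord} {c : Chord} (h : c ∈ S) : c.right ∈ endpoints S :=
  mem_endpoints.2 ⟨c, h, .inr rfl⟩

theorem endpoints_mono {S T : Finset Chord} (h : S ⊆ T) : endpoints S ⊆ endpoints T :=
  Finset.union_subset_union (Finset.image_subset_image h) (Finset.image_subset_image h)

theorem endpoints_union (S T : Finset Chord) : endpoints (S ∪ T) = endpoints S ∪ endpoints T := by
  ext x
  simp only [mem_endpoints, Finset.mem_union]
  grind

/-- The chord obtained by applying `f` to both endpoints of a chord. -/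
def relabel (f : ℕ → ℕ) (c : Chord) : Chord := mkChord (f c.left) (f c.right)

@[simp] theorem left_relabel (f : ℕ → ℕ) (c : Chord) : (relabel f c).left = f c.left := rfl

@[simp] theorem right_relabel (f : ℕ → ℕ) (c : Chord) : (relabel f c).right = f c.right := rfl

theorem endpoints_relabel (f : ℕ → ℕ) (S : Finset Chord) :
    endpoints (S.image (relabel f)) = (endpoints S).image f := by
  ext x
  simp only [mem_endpoints, Finset.mem_image]
  grind [left_relabel, right_relabel]

section Relabel

variable {f : ℕ → ℕ} {S : Finset Chord}

theorem strictMonoOn_endpoints_subset {T : Finset Chord} (hf : StrictMonoOn f (endpoints S))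
    (h : T ⊆ S) : StrictMonoOn f (endpoints T) :=
  hf.mono (Finset.coe_subset.2 (endpoints_mono h))

theorem relabel_injOn (hf : StrictMonoOn f (endpoints S)) :
    Set.InjOn (relabel f) (S : Set Chord) := by
  intro c hc c' hc' h
  rw [Chord.ext_iff] at h ⊢
  exact ⟨hf.injOn (left_mem_endpoints hc) (left_mem_endpoints hc') h.1,
    hf.injOn (right_mem_endpoints hc) (right_mem_endpoints hc') h.2⟩

theorem relabel_lt_iff (hf : StrictMonoOn f (endpoints S)) {c c' : Chord} (hc : c ∈ S)
    (hc' : c' ∈ S) : relabel f c < relabel f c' ↔ c < c' := by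
  rw [Chord.lt_iff, Chord.lt_iff]
  simp only [left_relabel, right_relabel]
  rw [hf.lt_iff_lt (left_mem_endpoints hc) (left_mem_endpoints hc'),
    hf.lt_iff_lt (right_mem_endpoints hc) (right_mem_endpoints hc'),
    hf.injOn.eq_iff (left_mem_endpoints hc) (left_mem_endpoints hc')]

theorem crosses_relabel_iff (hf : StrictMonoOn f (endpoints S)) {c c' : Chord} (hc : c ∈ S)
    (hc' : c' ∈ S) : Crosses (relabel f c) (relabel f c') ↔ Crosses c c' := by
  simp only [Crosses, left_relabel, right_relabel]
  rw [hf.lt_iff_lt (left_mem_endpoints hc) (left_mem_endpoints hc'),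
    hf.lt_iff_lt (right_mem_endpoints hc) (right_mem_endpoints hc'),
    hf.lt_iff_lt (left_mem_endpoints hc') (left_mem_endpoints hc),
    hf.lt_iff_lt (right_mem_endpoints hc') (right_mem_endpoints hc),
    hf.lt_iff_lt (left_mem_endpoints hc') (right_mem_endpoints hc),
    hf.lt_iff_lt (left_mem_endpoints hc) (right_mem_endpoints hc')]

end Relabel

/-! ### Roots -/

theorem root_le {S : Finset Chord} {c : Chord} (h : c ∈ S) : root S ≤ c := by
  rw [root, dif_pos ⟨c, h⟩]
  exact S.min'_le c h

theorem root_eq {S : Finset Chord} {c : Chord} (h : c ∈ S) (h' : ∀ c' ∈ S, c ≤ c') :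
    root S = c :=
  le_antisymm (root_le h) (h' _ (root_mem (Finset.ne_empty_of_mem h)))

theorem left_root_le {S : Finset Chord} {c : Chord} (h : c ∈ S) : (root S).left ≤ c.left := by
  rcases (root_le h).lt_or_eq with h | h
  · rw [Chord.lt_iff] at h
    omega
  · rw [h]

theorem root_relabel {f : ℕ → ℕ} {S : Finset Chord} (hf : StrictMonoOn f (endpoints S))
    (hS : S ≠ ∅) : root (S.image (relabel f)) = relabel f (root S) := by
  refine root_eq (Finset.mem_image_of_mem _ (root_mem hS)) fun c' h => ?_
  obtain ⟨c, hc, rfl⟩ := Finset.mem_image.1 h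
  rw [← not_lt, relabel_lt_iff hf hc (root_mem hS), not_lt]
  exact root_le hc

/-! ### Connectedness -/

/-- Two chords of `S` are linked if they are joined by a path in the intersection graph. -/
def Linked (S : Finset Chord) : Chord → Chord → Prop :=
  Relation.ReflTransGen fun c c' => c ∈ S ∧ c' ∈ S ∧ Crosses c c'

theorem reachable_iff_linked {S : Finset Chord} (c c' : S) :
    (intersectionGraph S).Reachable c c' ↔ Linked S c c' := by
  rw [SimpleGraph.reachable_iff_reflTransGen]
  constructor
  · intro h
    exact Relation.ReflTransGen.lift (fun c : S => (c : Chord)) (fun a b h => ⟨a.2, b.2, h⟩) _ _ h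
  · obtain ⟨c', hc'⟩ := c'
    intro h
    change Linked S c c' at h
    induction h with
    | refl => exact .refl
    | tail _ h ih => exact (ih h.1).tail h.2.2

theorem Linked.symm {S : Finset Chord} {c c' : Chord} (h : Linked S c c') : Linked S c' c :=
  have : Std.Symm fun c c' => c ∈ S ∧ c' ∈ S ∧ Crosses c c' :=
    ⟨fun _ _ h => ⟨h.2.1, h.1, h.2.2.symm⟩⟩
  Relation.ReflTransGen.stdSymm.symm _ _ h

theorem Linked.mono {S T : Finset Chord} (hST : S ⊆ T) {c c' : Chord} (h : Linked S c c') :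
    Linked T c c' :=
  Relation.ReflTransGen.mono (fun _ _ h => ⟨hST h.1, hST h.2.1, h.2.2⟩) _ _ h

theorem mem_component {S : Finset Chord} {c c' : Chord} :
    c' ∈ component S c ↔ c ∈ S ∧ c' ∈ S ∧ Linked S c c' := by
  simp only [component, Finset.mem_filter, reachable_iff_linked]
  constructor
  · rintro ⟨_, h, h', hl⟩
    exact ⟨h, h', hl⟩
  · rintro ⟨h, h', hl⟩
    exact ⟨h', h, h', hl⟩

/-- A set of chords with a connected intersection graph. -/
def IsConnected (S : Finset Chord) : Prop :=
  S ≠ ∅ ∧ ∀ c ∈ S, ∀ c' ∈ S, Linked S c c'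

theorem isConnected_iff {S : Finset Chord} :
    (intersectionGraph S).Connected ↔ IsConnected S := by
  rw [SimpleGraph.connected_iff]
  constructor
  · rintro ⟨h, ⟨c⟩⟩
    exact ⟨Finset.ne_empty_of_mem c.2, fun c hc c' hc' =>
      (reachable_iff_linked ⟨c, hc⟩ ⟨c', hc'⟩).1 (h _ _)⟩
  · rintro ⟨h, h'⟩
    exact ⟨fun c c' => (reachable_iff_linked _ _).2 (h' _ c.2 _ c'.2),
      ⟨⟨_, root_mem h⟩⟩⟩

theorem linked_relabel {f : ℕ → ℕ} {S : Finset Chord} (hf : StrictMonoOn f (endpoints S))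
    {c c' : Chord} (h : Linked S c c') :
    Linked (S.image (relabel f)) (relabel f c) (relabel f c') :=
  Relation.ReflTransGen.lift (relabel f) (fun _ _ h => ⟨Finset.mem_image_of_mem _ h.1,
    Finset.mem_image_of_mem _ h.2.1, (crosses_relabel_iff hf h.1 h.2.1).2 h.2.2⟩) _ _ h

theorem linked_of_linked_relabel {f : ℕ → ℕ} {S : Finset Chord}
    (hf : StrictMonoOn f (endpoints S)) {c c' : Chord} (hc : c ∈ S) (hc' : c' ∈ S)
    (h : Linked (S.image (relabel f)) (relabel f c) (relabel f c')) : Linked S c c' := by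
  generalize hd : relabel f c' = d' at h
  induction h generalizing c' with
  | refl => rw [relabel_injOn hf hc' hc hd]; exact .refl
  | tail _ h ih =>
    obtain ⟨e, he, he'⟩ := Finset.mem_image.1 h.1
    subst hd
    refine (ih he he').tail ⟨he, hc', ?_⟩
    rw [← crosses_relabel_iff hf he hc', he']
    exact h.2.2

theorem isConnected_relabel_iff {f : ℕ → ℕ} {S : Finset Chord}
    (hf : StrictMonoOn f (endpoints S)) :
    IsConnected (S.image (relabel f)) ↔ IsConnected S := by
  simp only [IsConnected, ne_eq, Finset.image_eq_empty, Finset.forall_mem_image]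
  exact and_congr_right fun _ => ⟨fun h c hc c' hc' =>
    linked_of_linked_relabel hf hc hc' (h hc hc'), fun h c hc c' hc' =>
    linked_relabel hf (h c hc c' hc')⟩

theorem component_relabel {f : ℕ → ℕ} {S : Finset Chord} (hf : StrictMonoOn f (endpoints S))
    {c : Chord} (hc : c ∈ S) :
    component (S.image (relabel f)) (relabel f c) = (component S c).image (relabel f) := by
  ext d
  simp only [mem_component, Finset.mem_image]
  constructor
  · rintro ⟨_, ⟨e, he, rfl⟩, hl⟩
    exact ⟨e, ⟨hc, he, linked_of_linked_relabel hf hc he hl⟩, rfl⟩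
  · rintro ⟨e, ⟨_, he, hl⟩, rfl⟩
    exact ⟨⟨c, hc, rfl⟩, ⟨e, he, rfl⟩, linked_relabel hf hl⟩

/-- A property that is preserved by crossings is preserved along paths. -/
theorem Linked.induction {S : Finset Chord} {c c' : Chord} (h : Linked S c c') {P : Chord → Prop}
    (hc : P c) (hP : ∀ d ∈ S, ∀ d' ∈ S, Crosses d d' → P d → P d') : P c' := by
  induction h with
  | refl => exact hc
  | tail _ h ih => exact hP _ h.1 _ h.2.1 h.2.2 ih

theorem not_crosses_component {S : Finset Chord} {r c d : Chord} (hc : c ∈ component S r)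
    (hd : d ∈ S) (hd' : d ∉ component S r) : ¬ Crosses c d := fun h => by
  rw [mem_component] at hc hd'
  exact hd' ⟨hc.1, hd, hc.2.2.tail ⟨hc.2.1, hd, h⟩⟩

theorem isConnected_component {S : Finset Chord} {r : Chord} (hr : r ∈ S) :
    IsConnected (component S r) := by
  have key : ∀ c ∈ component S r, Linked (component S r) r c := by
    intro c hc
    have hl := (mem_component.1 hc).2.2
    refine (hl.induction (P := fun c => c ∈ component S r ∧ Linked (component S r) r c)
      ⟨mem_component_self hr, .refl⟩ ?_).2
    rintro d hd d' hd' hdd' ⟨h1, h2⟩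
    have h3 : d' ∈ component S r := by
      by_contra h
      exact not_crosses_component h1 hd' h hdd'
    exact ⟨h3, h2.tail ⟨h1, h3, hdd'⟩⟩
  exact ⟨Finset.ne_empty_of_mem (mem_component_self hr), fun c hc c' hc' =>
    (key c hc).symm.trans (key c' hc')⟩

/-- A path that starts in `K` can never leave it. This is the criterion by which the first component
of an insertion is recognized. -/
theorem component_eq {S K : Finset Chord} (hKS : K ⊆ S) (hK : IsConnected K)
    (h : ∀ c ∈ K, ∀ d ∈ S, d ∉ K → ¬ Crosses c d) {c : Chord} (hc : c ∈ K) :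
    component S c = K := by
  ext d
  rw [mem_component]
  constructor
  · rintro ⟨_, _, hl⟩
    refine hl.induction (P := (· ∈ K)) hc fun e _ e' he' hee' he => ?_
    by_contra h'
    exact h e he e' he' h' hee'
  · exact fun hd => ⟨hKS hc, hKS hd, (hK.2 c hc d hd).mono hKS⟩

theorem IsConnected.component_eq {S : Finset Chord} (h : IsConnected S) {c : Chord} (hc : c ∈ S) :
    component S c = S :=
  ChordDSE.component_eq subset_rfl h (fun _ _ _ hd hd' => absurd hd hd') hc

/-- Otherwise `K` would be closed under crossings and would contain everything linked to it. -/
theorem IsConnected.exists_crosses {S K : Finset Chord} (h : IsConnected S) (hKS : K ⊂ S)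
    (hK : K.Nonempty) : ∃ c ∈ K, ∃ d ∈ S, d ∉ K ∧ Crosses c d := by
  by_contra! hn
  obtain ⟨c, hc⟩ := hK
  obtain ⟨d, hd, hd'⟩ := Finset.exists_of_ssubset hKS
  refine hd' ((h.2 c (hKS.1 hc) d hd).induction (P := (· ∈ K)) hc fun e _ e' he' hee' he => ?_)
  by_contra h'
  exact hn e he e' he' h' hee'

/-! ### Intersection order -/

theorem image_relabel_sdiff {f : ℕ → ℕ} {S T : Finset Chord} (hf : StrictMonoOn f (endpoints S))
    (hT : T ⊆ S) :
    (S \ T).image (relabel f) = S.image (relabel f) \ T.image (relabel f) :=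
  Finset.image_sdiff_of_injOn (relabel_injOn hf) hT

theorem image_relabel_erase {f : ℕ → ℕ} {S : Finset Chord} (hf : StrictMonoOn f (endpoints S))
    {c : Chord} (hc : c ∈ S) :
    (S.erase c).image (relabel f) = (S.image (relabel f)).erase (relabel f c) := by
  rw [Finset.erase_eq, Finset.erase_eq, image_relabel_sdiff hf (by simpa using hc),
    Finset.image_singleton]

theorem intersectionOrder_empty : intersectionOrder ∅ = [] := by
  rw [intersectionOrder, dif_pos rfl]

theorem intersectionOrder_of_ne_empty {S : Finset Chord} (h : S ≠ ∅) :
    intersectionOrder S = root S :: (intersectionOrder ((component S (root S)).erase (root S)) ++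
      intersectionOrder (S \ component S (root S))) := by
  rw [intersectionOrder, dif_neg h]

theorem card_component_erase_lt {S : Finset Chord} (h : S ≠ ∅) :
    ((component S (root S)).erase (root S)).card < S.card :=
  lt_of_lt_of_le (Finset.card_erase_lt_of_mem (mem_component_self (root_mem h)))
    (Finset.card_le_card (component_subset _ _))

theorem card_sdiff_component_lt {S : Finset Chord} (h : S ≠ ∅) :
    (S \ component S (root S)).card < S.card :=
  Finset.card_lt_card (Finset.sdiff_ssubset (component_subset _ _)
    ⟨_, mem_component_self (root_mem h)⟩)

theorem mem_intersectionOrder (S : Finset Chord) (c : Chord) :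
    c ∈ intersectionOrder S ↔ c ∈ S := by
  induction hn : S.card using Nat.strong_induction_on generalizing S with
  | _ n ih =>
    subst hn
    by_cases h : S = ∅
    · simp [h, intersectionOrder_empty]
    · rw [intersectionOrder_of_ne_empty h, List.mem_cons, List.mem_append,
        ih _ (card_component_erase_lt h) _ rfl, ih _ (card_sdiff_component_lt h) _ rfl]
      have h1 := root_mem h
      have h2 := mem_component_self h1
      have h3 := component_subset S (root S)
      simp only [Finset.mem_erase, Finset.mem_sdiff]
      constructor
      · rintro (rfl | ⟨_, h⟩ | ⟨h, _⟩)
        exacts [h1, h3 h, h]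
      · tauto

theorem nodup_intersectionOrder (S : Finset Chord) : (intersectionOrder S).Nodup := by
  induction hn : S.card using Nat.strong_induction_on generalizing S with
  | _ n ih =>
    subst hn
    by_cases h : S = ∅
    · simp [h, intersectionOrder_empty]
    · rw [intersectionOrder_of_ne_empty h, List.nodup_cons, List.nodup_append]
      have h2 := mem_component_self (root_mem h)
      simp only [List.mem_append, mem_intersectionOrder, Finset.mem_erase, Finset.mem_sdiff]
      refine ⟨by tauto, ih _ (card_component_erase_lt h) _ rfl,
        ih _ (card_sdiff_component_lt h) _ rfl, ?_⟩
      rintro a ⟨_, ha⟩ b ⟨_, hb⟩ rfl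
      exact hb ha

theorem intersectionOrder_relabel {f : ℕ → ℕ} {S : Finset Chord}
    (hf : StrictMonoOn f (endpoints S)) :
    intersectionOrder (S.image (relabel f)) = (intersectionOrder S).map (relabel f) := by
  induction hn : S.card using Nat.strong_induction_on generalizing S with
  | _ n ih =>
    subst hn
    by_cases h : S = ∅
    · simp [h, intersectionOrder_empty]
    · have h1 := component_subset S (root S)
      rw [intersectionOrder_of_ne_empty h, intersectionOrder_of_ne_empty (by simpa using h),
        root_relabel hf h, component_relabel hf (root_mem h),
        ← image_relabel_erase (strictMonoOn_endpoints_subset hf h1)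
          (mem_component_self (root_mem h)), ← image_relabel_sdiff hf h1,
        ih _ (card_component_erase_lt h)
          (strictMonoOn_endpoints_subset hf ((Finset.erase_subset _ _).trans h1)) rfl,
        ih _ (card_sdiff_component_lt h)
          (strictMonoOn_endpoints_subset hf Finset.sdiff_subset) rfl]
      simp

theorem root_component_root {S : Finset Chord} (h : S ≠ ∅) :
    root (component S (root S)) = root S :=
  root_eq (mem_component_self (root_mem h)) fun _ hc => root_le (component_subset _ _ hc)

theorem intersectionOrder_of_isConnected {S : Finset Chord} (h : IsConnected S) :
    intersectionOrder S = root S :: intersectionOrder (S.erase (root S)) := by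
  rw [intersectionOrder_of_ne_empty h.1, h.component_eq (root_mem h.1), Finset.sdiff_self,
    intersectionOrder_empty, List.append_nil]

/-- The recursive definition splits off the root as well; in this form whole components can be
compared. -/
theorem intersectionOrder_eq_append (S : Finset Chord) :
    intersectionOrder S = intersectionOrder (component S (root S)) ++
      intersectionOrder (S \ component S (root S)) := by
  by_cases h : S = ∅
  · subst h
    simp [component, intersectionOrder_empty]
  · rw [intersectionOrder_of_isConnected (isConnected_component (root_mem h)),
      intersectionOrder_of_ne_empty h, root_component_root h, List.cons_append]

/-! ### Terminal chords -/

/-- A chord is terminal in `S` if it crosses no chord of `S` with a larger first endpoint. -/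
def Terminal (S : Finset Chord) (c : Chord) : Prop :=
  ∀ c' ∈ S, c.left < c'.left → ¬ Crosses c c'

instance (S : Finset Chord) : DecidablePred (Terminal S) :=
  fun c => by unfold Terminal; infer_instance

theorem terminal_relabel_iff {f : ℕ → ℕ} {S : Finset Chord} (hf : StrictMonoOn f (endpoints S))
    {c : Chord} (hc : c ∈ S) : Terminal (S.image (relabel f)) (relabel f c) ↔ Terminal S c := by
  simp only [Terminal, Finset.forall_mem_image, left_relabel]
  refine forall₂_congr fun d hd => ?_
  rw [hf.lt_iff_lt (left_mem_endpoints hc) (left_mem_endpoints hd), crosses_relabel_iff hf hc hd]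

/-- The last chord in the intersection order is terminal. -/
theorem exists_terminal_last {S : Finset Chord} (h : S ≠ ∅) :
    ∃ L c, intersectionOrder S = L ++ [c] ∧ Terminal S c := by
  induction hn : S.card using Nat.strong_induction_on generalizing S with
  | _ n ih =>
    subst hn
    have hr := root_mem h
    have hrc := mem_component_self hr
    by_cases h1 : S \ component S (root S) = ∅
    · have h3 : component S (root S) = S :=
        (component_subset _ _).antisymm (Finset.sdiff_eq_empty_iff_subset.1 h1)
      by_cases h2 : S.erase (root S) = ∅
      · refine ⟨[], root S, ?_, fun c hc hlt => ?_⟩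
        · rw [intersectionOrder_of_ne_empty h, h1, h3, h2, intersectionOrder_empty]
          rfl
        · have : c = root S := by
            by_contra hne
            exact Finset.notMem_empty c (h2 ▸ Finset.mem_erase.2 ⟨hne, hc⟩)
          exact absurd (this ▸ hlt) (lt_irrefl _)
      · obtain ⟨L, c, hL, hc⟩ := ih _ (Finset.card_erase_lt_of_mem hr) h2 rfl
        have hcS : c ∈ S.erase (root S) := by
          rw [← mem_intersectionOrder, hL]
          simp
        refine ⟨root S :: L, c, ?_, fun d hd hlt => ?_⟩
        · rw [intersectionOrder_of_ne_empty h, h1, h3, intersectionOrder_empty, hL,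
            List.append_nil, List.cons_append]
        -- The root has the smallest first endpoint, so restoring it cannot destroy terminality.
        · refine hc d (Finset.mem_erase.2 ⟨?_, hd⟩) hlt
          rintro rfl
          exact absurd (left_root_le (Finset.mem_of_mem_erase hcS)) (not_le.2 hlt)
    · obtain ⟨L, c, hL, hc⟩ := ih _ (card_sdiff_component_lt h) h1 rfl
      have hcS : c ∈ S \ component S (root S) := by
        rw [← mem_intersectionOrder, hL]
        simp
      rw [Finset.mem_sdiff] at hcS
      refine ⟨intersectionOrder (component S (root S)) ++ L, c, ?_, fun d hd hlt => ?_⟩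
      · rw [intersectionOrder_eq_append, hL, List.append_assoc]
      · by_cases hd' : d ∈ component S (root S)
        · exact fun hx => not_crosses_component hd' hcS.1 hcS.2 hx.symm
        · exact hc d (Finset.mem_sdiff.2 ⟨hd, hd'⟩) hlt

/-! ### Matchings and diagrams -/

/-- A set of chords with pairwise distinct endpoints. -/
structure IsMatching (S : Finset Chord) : Prop where
  lt : ∀ c ∈ S, c.left < c.right
  left_inj : ∀ c ∈ S, ∀ c' ∈ S, c.left = c'.left → c = c'
  right_inj : ∀ c ∈ S, ∀ c' ∈ S, c.right = c'.right → c = c'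
  left_ne_right : ∀ c ∈ S, ∀ c' ∈ S, c.left ≠ c'.right

/-- A set of chords whose endpoints are pairwise distinct and form an interval starting at `1`. -/
structure IsDiagram (S : Finset Chord) : Prop extends IsMatching S where
  endpoints_eq : endpoints S = Finset.Icc 1 (2 * S.card)

theorem IsMatching.mono {S T : Finset Chord} (h : IsMatching S) (hT : T ⊆ S) : IsMatching T where
  lt c hc := h.lt c (hT hc)
  left_inj c hc c' hc' := h.left_inj c (hT hc) c' (hT hc')
  right_inj c hc c' hc' := h.right_inj c (hT hc) c' (hT hc')
  left_ne_right c hc c' hc' := h.left_ne_right c (hT hc) c' (hT hc')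

theorem IsMatching.relabel {f : ℕ → ℕ} {S : Finset Chord} (h : IsMatching S)
    (hf : StrictMonoOn f (endpoints S)) : IsMatching (S.image (relabel f)) where
  lt := Finset.forall_mem_image.2 fun c hc =>
    hf (left_mem_endpoints hc) (right_mem_endpoints hc) (h.lt c hc)
  left_inj := Finset.forall_mem_image.2 fun c hc => Finset.forall_mem_image.2 fun c' hc' he => by
    rw [h.left_inj c hc c' hc' (hf.injOn (left_mem_endpoints hc) (left_mem_endpoints hc') he)]
  right_inj := Finset.forall_mem_image.2 fun c hc => Finset.forall_mem_image.2 fun c' hc' he => by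
    rw [h.right_inj c hc c' hc' (hf.injOn (right_mem_endpoints hc) (right_mem_endpoints hc') he)]
  left_ne_right := Finset.forall_mem_image.2 fun c hc =>
    Finset.forall_mem_image.2 fun c' hc' he => h.left_ne_right c hc c' hc'
      (hf.injOn (left_mem_endpoints hc) (right_mem_endpoints hc') he)

theorem IsMatching.union {S T : Finset Chord} (hS : IsMatching S) (hT : IsMatching T)
    (h : Disjoint (endpoints S) (endpoints T)) : IsMatching (S ∪ T) := by
  rw [Finset.disjoint_left] at h
  refine ⟨?_, ?_, ?_, ?_⟩
  · intro c hc
    rcases Finset.mem_union.1 hc with hc | hc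
    exacts [hS.lt c hc, hT.lt c hc]
  · intro c hc c' hc' he
    rcases Finset.mem_union.1 hc with hc | hc <;> rcases Finset.mem_union.1 hc' with hc' | hc'
    · exact hS.left_inj c hc c' hc' he
    · exact absurd (left_mem_endpoints hc') (he ▸ h (left_mem_endpoints hc))
    · exact absurd (left_mem_endpoints hc) (he ▸ h (left_mem_endpoints hc'))
    · exact hT.left_inj c hc c' hc' he
  · intro c hc c' hc' he
    rcases Finset.mem_union.1 hc with hc | hc <;> rcases Finset.mem_union.1 hc' with hc' | hc'
    · exact hS.right_inj c hc c' hc' he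
    · exact absurd (right_mem_endpoints hc') (he ▸ h (right_mem_endpoints hc))
    · exact absurd (right_mem_endpoints hc) (he ▸ h (right_mem_endpoints hc'))
    · exact hT.right_inj c hc c' hc' he
  · intro c hc c' hc' he
    rcases Finset.mem_union.1 hc with hc | hc <;> rcases Finset.mem_union.1 hc' with hc' | hc'
    · exact hS.left_ne_right c hc c' hc' he
    · exact absurd (right_mem_endpoints hc') (he ▸ h (left_mem_endpoints hc))
    · exact absurd (left_mem_endpoints hc) (he ▸ h (right_mem_endpoints hc'))
    · exact hT.left_ne_right c hc c' hc' he

theorem IsMatching.disjoint_endpoints {S A B : Finset Chord} (h : IsMatching S) (hA : A ⊆ S)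
    (hB : B ⊆ S) (hAB : Disjoint A B) : Disjoint (endpoints A) (endpoints B) := by
  rw [Finset.disjoint_left] at hAB ⊢
  intro x hxA hxB
  obtain ⟨c, hc, hcx⟩ := mem_endpoints.1 hxA
  obtain ⟨d, hd, hdx⟩ := mem_endpoints.1 hxB
  have hcd : c ≠ d := fun he => hAB hc (he ▸ hd)
  have h1 := h.left_inj c (hA hc) d (hB hd)
  have h2 := h.right_inj c (hA hc) d (hB hd)
  have h3 := h.left_ne_right c (hA hc) d (hB hd)
  have h4 := h.left_ne_right d (hB hd) c (hA hc)
  rcases hcx with hcx | hcx <;> rcases hdx with hdx | hdx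
  · exact hcd (h1 (hcx.trans hdx.symm))
  · exact h3 (hcx.trans hdx.symm)
  · exact h4 (hdx.trans hcx.symm)
  · exact hcd (h2 (hcx.trans hdx.symm))

theorem IsMatching.card_endpoints {S : Finset Chord} (h : IsMatching S) :
    (endpoints S).card = 2 * S.card := by
  rw [endpoints, Finset.card_union_of_disjoint, Finset.card_image_of_injOn,
    Finset.card_image_of_injOn, two_mul]
  · exact fun c hc c' hc' he => h.right_inj c hc c' hc' he
  · exact fun c hc c' hc' he => h.left_inj c hc c' hc' he
  · rw [Finset.disjoint_left]
    rintro x hx hx'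
    obtain ⟨c, hc, rfl⟩ := Finset.mem_image.1 hx
    obtain ⟨c', hc', he⟩ := Finset.mem_image.1 hx'
    exact h.left_ne_right c hc c' hc' he.symm

theorem IsDiagram.mem_endpoints_iff {S : Finset Chord} (h : IsDiagram S) {x : ℕ} :
    x ∈ endpoints S ↔ 1 ≤ x ∧ x ≤ 2 * S.card := by
  rw [h.endpoints_eq, Finset.mem_Icc]

theorem IsDiagram.one_le_left {S : Finset Chord} (h : IsDiagram S) {c : Chord} (hc : c ∈ S) :
    1 ≤ c.left := (h.mem_endpoints_iff.1 (left_mem_endpoints hc)).1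

theorem IsDiagram.right_le {S : Finset Chord} (h : IsDiagram S) {c : Chord} (hc : c ∈ S) :
    c.right ≤ 2 * S.card := (h.mem_endpoints_iff.1 (right_mem_endpoints hc)).2

theorem IsDiagram.left_root {S : Finset Chord} (h : IsDiagram S) (hS : S ≠ ∅) :
    (root S).left = 1 := by
  have hpos := Finset.card_pos.2 (Finset.nonempty_iff_ne_empty.2 hS)
  obtain ⟨c, hc, hc'⟩ := mem_endpoints.1 ((h.mem_endpoints_iff (x := 1)).2 (by omega))
  have h1 := h.lt c hc
  have h2 := h.one_le_left hc
  have h3 := left_root_le hc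
  have h4 := h.one_le_left (root_mem hS)
  omega

theorem IsDiagram.one_lt_left {S : Finset Chord} (h : IsDiagram S) {c : Chord} (hc : c ∈ S)
    (hr : c ≠ root S) : 1 < c.left := by
  have h1 := h.one_le_left hc
  have hS := Finset.ne_empty_of_mem hc
  have h2 := h.left_root hS
  have h3 := mt (h.left_inj c hc _ (root_mem hS)) hr
  omega

/-! ### Normalization -/

/-- The number of endpoints of chords in `S` that are at most `x`. -/
def rank (S : Finset Chord) (x : ℕ) : ℕ := ((endpoints S).filter (· ≤ x)).card

theorem norm_eq_image (S : Finset Chord) : norm S = S.image (relabel (rank S)) := rfl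

theorem strictMonoOn_rank (S : Finset Chord) : StrictMonoOn (rank S) (endpoints S) := by
  intro x _ y hy hxy
  refine Finset.card_lt_card (Finset.ssubset_iff_of_subset ?_ |>.2 ⟨y, ?_, ?_⟩)
  · exact Finset.monotone_filter_right _ fun z _ hz => hz.trans hxy.le
  · exact Finset.mem_filter.2 ⟨hy, le_rfl⟩
  · simp [hxy]

theorem rank_relabel {f : ℕ → ℕ} {S : Finset Chord} (hf : StrictMonoOn f (endpoints S)) {x : ℕ}
    (hx : x ∈ endpoints S) : rank (S.image (relabel f)) (f x) = rank S x := by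
  have : (endpoints (S.image (relabel f))).filter (· ≤ f x) =
      ((endpoints S).filter (· ≤ x)).image f := by
    rw [endpoints_relabel, Finset.filter_image]
    congr 1
    exact Finset.filter_congr fun y hy => hf.le_iff_le hy hx
  rw [rank, this, Finset.card_image_of_injOn, rank]
  exact hf.injOn.mono (Finset.coe_subset.2 (Finset.filter_subset _ _))

/-- Ranks depend only on the relative order of the endpoints. -/
theorem norm_relabel {f : ℕ → ℕ} {S : Finset Chord} (hf : StrictMonoOn f (endpoints S)) :
    norm (S.image (relabel f)) = norm S := by
  rw [norm_eq_image, norm_eq_image, Finset.image_image]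
  refine Finset.image_congr fun c hc => Chord.ext_iff.2 ⟨?_, ?_⟩
  · exact rank_relabel hf (left_mem_endpoints hc)
  · exact rank_relabel hf (right_mem_endpoints hc)

/-- Ranks are injective on the endpoints and lie between `1` and the number of endpoints, so by
counting they fill the interval. -/
theorem IsMatching.isDiagram_norm {S : Finset Chord} (h : IsMatching S) : IsDiagram (norm S) := by
  have hf := strictMonoOn_rank S
  refine ⟨h.relabel hf, ?_⟩
  rw [norm_eq_image, endpoints_relabel, Finset.card_image_of_injOn (relabel_injOn hf)]
  refine Finset.eq_of_subset_of_card_le ?_ ?_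
  · intro y hy
    obtain ⟨x, hx, rfl⟩ := Finset.mem_image.1 hy
    rw [Finset.mem_Icc, ← h.card_endpoints]
    exact ⟨Finset.card_pos.2 ⟨x, Finset.mem_filter.2 ⟨hx, le_rfl⟩⟩,
      Finset.card_le_card (Finset.filter_subset _ _)⟩
  · rw [Finset.card_image_of_injOn hf.injOn, h.card_endpoints]
    simp

theorem IsDiagram.rank_eq {S : Finset Chord} (h : IsDiagram S) {x : ℕ} (hx : x ∈ endpoints S) :
    rank S x = x := by
  have : (endpoints S).filter (· ≤ x) = Finset.Icc 1 x := by
    ext y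
    have := h.mem_endpoints_iff.1 hx
    rw [Finset.mem_filter, h.mem_endpoints_iff, Finset.mem_Icc]
    omega
  rw [rank, this, Nat.card_Icc, Nat.add_sub_cancel]

theorem IsDiagram.norm_eq {S : Finset Chord} (h : IsDiagram S) : norm S = S := by
  rw [norm_eq_image]
  conv_rhs => rw [← Finset.image_id (s := S)]
  exact Finset.image_congr fun c hc => Chord.ext_iff.2
    ⟨h.rank_eq (left_mem_endpoints hc), h.rank_eq (right_mem_endpoints hc)⟩

theorem rank_of_disjoint_union {S A B : Finset Chord} (h : A ∪ B = S)
    (hd : Disjoint (endpoints A) (endpoints B)) (x : ℕ) : rank S x = rank A x + rank B x := by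
  rw [rank, ← h, endpoints_union, Finset.filter_union, Finset.card_union_of_disjoint
    (Finset.disjoint_filter_filter hd)]
  rfl

/-! ### The insertion of diagrams -/

/-- The map on endpoints by which `C` is embedded in `insertion C k D`. -/
def outer (k x : ℕ) : ℕ := if x ≤ 1 then x else x + k

theorem strictMono_outer (k : ℕ) : StrictMono (outer k) := by
  intro x y h
  unfold outer
  split_ifs <;> omega

/-- For `n = 0` the points `k` and `k + 1` would collide. -/
theorem strictMono_shift {n : ℕ} (hn : 0 < n) (k : ℕ) : StrictMono (shift n k) := by
  intro x y h
  unfold shift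
  split_ifs <;> omega

/-- The definition singles out one chord; since positions start at `1` and second endpoints exceed
`1`, the same effect is achieved by one increasing map of the points, to which all results on
`relabel` apply. -/
theorem IsDiagram.insertion_eq {C : Finset Chord} (hC : IsDiagram C) (k : ℕ) (D : Finset Chord) :
    insertion C k D = C.image (relabel (outer k)) ∪ D.image (relabel (shift C.card k)) := by
  unfold insertion
  congr 1
  refine Finset.image_congr fun c hc => Chord.ext_iff.2 ⟨?_, ?_⟩
  · have := hC.one_le_left hc
    simp only [left_mkChord, left_relabel, outer]
    split_ifs <;> omega
  · have h1 := hC.one_le_left hc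
    have h2 := hC.lt c hc
    simp only [right_mkChord, right_relabel, outer]
    split_ifs <;> omega

/-- Two connected diagrams and a position at which the first is inserted into the second. -/
structure Insertable (C : Finset Chord) (k : ℕ) (D : Finset Chord) : Prop where
  diagram_left : IsDiagram C
  diagram_right : IsDiagram D
  connected_left : IsConnected C
  connected_right : IsConnected D
  one_le : 1 ≤ k
  le : k ≤ 2 * D.card - 1

namespace Insertable

variable {C D : Finset Chord} {k : ℕ} (h : Insertable C k D)
include h

theorem card_left_pos : 0 < C.card :=
  Finset.card_pos.2 (Finset.nonempty_iff_ne_empty.2 h.connected_left.1)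

theorem strictMono_shift : StrictMono (shift C.card k) :=
  ChordDSE.strictMono_shift h.card_left_pos k

theorem card_right_pos : 0 < D.card :=
  Finset.card_pos.2 (Finset.nonempty_iff_ne_empty.2 h.connected_right.1)

/-- With `n = C.card`, the points of `C` go to `1` and to `k + 2, …, k + 2n`, those of `D` to `2, …,
k + 1` and to positions beyond `k + 2n`. -/
theorem disjoint_endpoints : Disjoint (endpoints (C.image (relabel (outer k))))
    (endpoints (D.image (relabel (shift C.card k)))) := by
  rw [endpoints_relabel, endpoints_relabel, Finset.disjoint_left]
  intro x hx hx'
  obtain ⟨y, hy, rfl⟩ := Finset.mem_image.1 hx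
  obtain ⟨z, hz, he⟩ := Finset.mem_image.1 hx'
  rw [h.diagram_left.mem_endpoints_iff] at hy
  rw [h.diagram_right.mem_endpoints_iff] at hz
  unfold outer shift at he
  split_ifs at he <;> omega

theorem disjoint : Disjoint (C.image (relabel (outer k))) (D.image (relabel (shift C.card k))) := by
  rw [Finset.disjoint_left]
  intro c hc hc'
  exact Finset.disjoint_left.1 h.disjoint_endpoints (left_mem_endpoints hc)
    (left_mem_endpoints hc')

theorem card_insertion : (insertion C k D).card = C.card + D.card := by
  rw [h.diagram_left.insertion_eq, Finset.card_union_of_disjoint h.disjoint,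
    Finset.card_image_of_injOn (relabel_injOn ((strictMono_outer k).strictMonoOn _)),
    Finset.card_image_of_injOn (relabel_injOn (h.strictMono_shift.strictMonoOn _))]

theorem isDiagram : IsDiagram (insertion C k D) := by
  have hm : IsMatching (insertion C k D) := by
    rw [h.diagram_left.insertion_eq]
    exact (h.diagram_left.relabel ((strictMono_outer k).strictMonoOn _)).union
      (h.diagram_right.relabel (h.strictMono_shift.strictMonoOn _)) h.disjoint_endpoints
  refine ⟨hm, Finset.eq_of_subset_of_card_le ?_ ?_⟩
  · rw [h.card_insertion, h.diagram_left.insertion_eq, endpoints_union, endpoints_relabel,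
      endpoints_relabel]
    have h1 := h.card_left_pos
    have h2 := h.le
    intro x hx
    rw [Finset.mem_Icc]
    rcases Finset.mem_union.1 hx with hx | hx
    · obtain ⟨y, hy, rfl⟩ := Finset.mem_image.1 hx
      rw [h.diagram_left.mem_endpoints_iff] at hy
      unfold outer
      split_ifs <;> omega
    · obtain ⟨y, hy, rfl⟩ := Finset.mem_image.1 hx
      rw [h.diagram_right.mem_endpoints_iff] at hy
      unfold shift
      split_ifs <;> omega
  · rw [hm.card_endpoints]
    simp

theorem subset_left : C.image (relabel (outer k)) ⊆ insertion C k D := by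
  rw [h.diagram_left.insertion_eq]
  exact Finset.subset_union_left

theorem subset_right : D.image (relabel (shift C.card k)) ⊆ insertion C k D := by
  rw [h.diagram_left.insertion_eq]
  exact Finset.subset_union_right

theorem mem_insertion {c : Chord} : c ∈ insertion C k D ↔
    c ∈ C.image (relabel (outer k)) ∨ c ∈ D.image (relabel (shift C.card k)) := by
  rw [h.diagram_left.insertion_eq, Finset.mem_union]

theorem root_eq : root (insertion C k D) = relabel (outer k) (root C) := by
  have hS := h.isDiagram
  have hr := h.subset_left (Finset.mem_image_of_mem _ (root_mem h.connected_left.1))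
  refine hS.left_inj _ (root_mem (Finset.ne_empty_of_mem hr)) _ hr ?_
  rw [hS.left_root (Finset.ne_empty_of_mem hr), left_relabel,
    h.diagram_left.left_root h.connected_left.1]
  rfl

/-- Both endpoints of `c` land in the block `k + 2, …, k + 2 * C.card`, which contains no point
coming from `D`. -/
theorem not_crosses {c : Chord} (hc : c ∈ C) (hr : c ≠ root C) (d : Chord) :
    ¬ Crosses (relabel (outer k) c) (relabel (shift C.card k) d) := by
  have h1 := h.diagram_left.one_lt_left hc hr
  have h2 := h.diagram_left.lt c hc
  have h3 := h.diagram_left.right_le hc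
  simp only [Crosses, left_relabel, right_relabel, outer, shift]
  split_ifs <;> omega

theorem erase_root_eq : (insertion C k D).erase (root (insertion C k D)) =
    (C.erase (root C)).image (relabel (outer k)) ∪ D.image (relabel (shift C.card k)) := by
  have hr := Finset.mem_image_of_mem (relabel (outer k)) (root_mem h.connected_left.1)
  rw [image_relabel_erase ((strictMono_outer k).strictMonoOn _) (root_mem h.connected_left.1),
    h.root_eq, h.diagram_left.insertion_eq, Finset.erase_union_distrib,
    Finset.erase_eq_of_notMem (Finset.disjoint_left.1 h.disjoint hr)]

/-- Because `1 ≤ k`, the root of `D` starts at position `2`, the first one available after the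
removal of the root. -/
theorem root_erase_root :
    root ((insertion C k D).erase (root (insertion C k D))) =
      relabel (shift C.card k) (root D) := by
  have h0 := Finset.mem_image_of_mem (relabel (shift C.card k)) (root_mem h.connected_right.1)
  have hr : relabel (shift C.card k) (root D) ∈
      (insertion C k D).erase (root (insertion C k D)) := by
    rw [h.erase_root_eq]
    exact Finset.mem_union_right _ h0
  have hne := Finset.ne_empty_of_mem hr
  have hm := root_mem hne
  have h1 := left_root_le hr
  have h2 := h.isDiagram.one_lt_left (Finset.mem_of_mem_erase hm) (Finset.ne_of_mem_erase hm)
  refine h.isDiagram.left_inj _ (Finset.mem_of_mem_erase hm) _ (h.subset_right h0) ?_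
  rw [left_relabel, h.diagram_right.left_root h.connected_right.1, shift, if_pos h.one_le] at h1 ⊢
  omega

theorem firstComponent_eq :
    firstComponent (insertion C k D) = D.image (relabel (shift C.card k)) := by
  rw [firstComponent, h.root_erase_root]
  refine component_eq ?_ ((isConnected_relabel_iff (h.strictMono_shift.strictMonoOn _)).2
    h.connected_right) ?_ (Finset.mem_image_of_mem _ (root_mem h.connected_right.1))
  · rw [h.erase_root_eq]
    exact Finset.subset_union_right
  · intro d hd c hc hc' hx
    rw [h.erase_root_eq, Finset.mem_union, or_iff_left hc'] at hc
    obtain ⟨d, -, rfl⟩ := Finset.mem_image.1 hd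
    obtain ⟨c, hce, rfl⟩ := Finset.mem_image.1 hc
    exact h.not_crosses (Finset.mem_of_mem_erase hce) (Finset.ne_of_mem_erase hce) d hx.symm

theorem sdiff_firstComponent_eq :
    insertion C k D \ firstComponent (insertion C k D) = C.image (relabel (outer k)) := by
  rw [h.firstComponent_eq, h.diagram_left.insertion_eq, Finset.union_sdiff_right,
    Finset.sdiff_eq_self_of_disjoint h.disjoint]

/-- It suffices that some chord of `D` starts at or before `k` and ends after `k`: the second
endpoint of the root of `C` is put into that gap. The bound `k ≤ 2 * D.card - 1` and the
connectedness of `D` provide such a chord. -/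
theorem exists_crosses_root : ∃ d ∈ D,
    Crosses (relabel (outer k) (root C)) (relabel (shift C.card k) d) := by
  have h0 := h.card_right_pos
  have h1 := h.one_le
  have h2 := h.le
  have hD := h.diagram_right
  have key : ∃ d ∈ D, d.left ≤ k ∧ k < d.right := by
    obtain ⟨e, he, he'⟩ := mem_endpoints.1 ((hD.mem_endpoints_iff (x := 2 * D.card)).2 (by omega))
    have h3 := hD.lt e he
    have h4 := hD.right_le he
    by_cases hek : e.left ≤ k
    · exact ⟨e, he, hek, by omega⟩
    -- If the chord ending at the last point starts after `k`, then some chord starting at or before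
    -- `k` crosses one starting after `k`, and so ends after `k`.
    · obtain ⟨c, hc, d, hd, hdc, hx⟩ := h.connected_right.exists_crosses
        (K := D.filter fun d => d.left ≤ k)
        (Finset.ssubset_iff_of_subset (Finset.filter_subset _ _) |>.2 ⟨e, he, by simp [hek]⟩)
        ⟨root D, Finset.mem_filter.2 ⟨root_mem h.connected_right.1, by
          rwa [hD.left_root h.connected_right.1]⟩⟩
      rw [Finset.mem_filter] at hc hdc
      have h5 : ¬ d.left ≤ k := fun h => hdc ⟨hd, h⟩
      refine ⟨c, hc.1, hc.2, ?_⟩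
      unfold Crosses at hx
      omega
  obtain ⟨d, hd, h3, h4⟩ := key
  have hr := root_mem h.connected_left.1
  have h5 := h.diagram_left.left_root h.connected_left.1
  have h6 := h.diagram_left.lt _ hr
  have h7 := h.diagram_left.right_le hr
  have h8 := hD.one_le_left hd
  refine ⟨d, hd, .inl ?_⟩
  simp only [left_relabel, right_relabel, outer, shift]
  split_ifs <;> omega

theorem isConnected : IsConnected (insertion C k D) := by
  have h1 := h.subset_left
  have h2 := h.subset_right
  have hC := (isConnected_relabel_iff ((strictMono_outer k).strictMonoOn _)).2 h.connected_left
  have hD := (isConnected_relabel_iff (h.strictMono_shift.strictMonoOn _)).2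
    h.connected_right
  have hr := Finset.mem_image_of_mem (relabel (outer k)) (root_mem h.connected_left.1)
  obtain ⟨d, hd, hx⟩ := h.exists_crosses_root
  have hd := Finset.mem_image_of_mem (relabel (shift C.card k)) hd
  have key : ∀ c ∈ insertion C k D, Linked (insertion C k D) (relabel (outer k) (root C)) c := by
    intro c hc
    rcases h.mem_insertion.1 hc with hc | hc
    · exact (hC.2 _ hr _ hc).mono h1
    · exact .head ⟨h1 hr, h2 hd, hx⟩ ((hD.2 _ hd _ hc).mono h2)
  exact ⟨Finset.ne_empty_of_mem (h1 hr), fun c hc c' hc' => (key c hc).symm.trans (key c' hc')⟩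

theorem insertionIndex_eq : insertionIndex (insertion C k D) = k := by
  have key : ((Finset.Icc 1 (2 * (firstComponent (insertion C k D)).card - 1)).filter fun k' =>
      norm (insertion C k D) = insertion (norm (insertion C k D \
        firstComponent (insertion C k D))) k' (norm (firstComponent (insertion C k D)))) = {k} := by
    rw [h.sdiff_firstComponent_eq, h.firstComponent_eq, h.isDiagram.norm_eq,
      norm_relabel ((strictMono_outer k).strictMonoOn _),
      norm_relabel (h.strictMono_shift.strictMonoOn _),
      h.diagram_left.norm_eq, h.diagram_right.norm_eq,
      Finset.card_image_of_injOn (relabel_injOn (h.strictMono_shift.strictMonoOn _))]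
    ext k'
    rw [Finset.mem_filter, Finset.mem_Icc, Finset.mem_singleton]
    constructor
    · rintro ⟨⟨h1, h2⟩, he⟩
      have h' : Insertable C k' D := { h with one_le := h1, le := h2 }
      -- The second endpoint of the root is `y + k`, with `y` determined by `C`, so it reveals `k`.
      have hr := congrArg (fun S => (root S).right) he
      have h5 := h.diagram_left.left_root h.connected_left.1
      have h6 := h.diagram_left.lt _ (root_mem h.connected_left.1)
      simp only [h.root_eq, h'.root_eq, right_relabel, outer] at hr
      split_ifs at hr <;> omega
    · rintro rfl
      exact ⟨⟨h.one_le, h.le⟩, rfl⟩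
  rw [insertionIndex, key]
  simp

end Insertable

/-! ### The root share decomposition -/

/-- A component of what is left after the removal of the root is joined to the rest of `S` only
through the root. -/
theorem IsConnected.exists_crosses_root {S : Finset Chord} (h : IsConnected S) {c : Chord}
    (hc : c ∈ S.erase (root S)) :
    ∃ d ∈ component (S.erase (root S)) c, Crosses (root S) d := by
  have hsub := component_subset (S.erase (root S)) c
  obtain ⟨d, hd, e, he, he', hx⟩ := h.exists_crosses
    (K := component (S.erase (root S)) c)
    (Finset.ssubset_iff_of_subset (hsub.trans (Finset.erase_subset _ _)) |>.2
      ⟨root S, root_mem h.1, fun hr => Finset.ne_of_mem_erase (hsub hr) rfl⟩)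
    ⟨c, mem_component_self hc⟩
  have : e = root S := by
    by_contra hne
    exact not_crosses_component hd (Finset.mem_erase.2 ⟨hne, he⟩) he' hx
  exact ⟨d, hd, this ▸ hx.symm⟩

theorem root_notMem_firstComponent (S : Finset Chord) : root S ∉ firstComponent S := fun h =>
  Finset.ne_of_mem_erase (firstComponent_subset S h) rfl

/-- Each of the remaining components is still attached to the root. -/
theorem IsConnected.sdiff_firstComponent {S : Finset Chord} (h : IsConnected S) :
    IsConnected (S \ firstComponent S) := by
  have hr : root S ∈ S \ firstComponent S :=
    Finset.mem_sdiff.2 ⟨root_mem h.1, root_notMem_firstComponent S⟩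
  have key : ∀ c ∈ S \ firstComponent S, Linked (S \ firstComponent S) (root S) c := by
    intro c hc
    by_cases hcr : c = root S
    · exact hcr ▸ .refl
    · rw [Finset.mem_sdiff] at hc
      have hce : c ∈ S.erase (root S) := Finset.mem_erase.2 ⟨hcr, hc.1⟩
      obtain ⟨d, hd, hx⟩ := h.exists_crosses_root hce
      have hsub : component (S.erase (root S)) c ⊆ S \ firstComponent S := by
        intro e he
        have he' := mem_component.1 he
        refine Finset.mem_sdiff.2 ⟨Finset.mem_of_mem_erase he'.2.1, fun hf => hc.2 ?_⟩
        have hf' := mem_component.1 hf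
        exact mem_component.2 ⟨hf'.1, hce, hf'.2.2.trans he'.2.2.symm⟩
      exact .head ⟨hr, hsub hd, hx⟩ (((isConnected_component hce).2 d hd c
        (mem_component_self hce)).mono hsub)
  exact ⟨Finset.ne_empty_of_mem hr, fun c hc c' hc' => (key c hc).symm.trans (key c' hc')⟩

section Decomposition

variable {S : Finset Chord} (hS : IsDiagram S)
include hS

/-- An endpoint of the first component cannot lie between the endpoints of a chord of another
component. -/
theorem lt_left_iff_lt_right_of_mem_firstComponent (h2 : S.erase (root S) ≠ ∅) {c : Chord}
    (hcS : c ∈ S)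
    (hc1 : c ∉ firstComponent S) (hcr : c ≠ root S) {p : ℕ}
    (hp : p ∈ endpoints (firstComponent S)) : p < c.left ↔ p < c.right := by
  have hce : c ∈ S.erase (root S) := Finset.mem_erase.2 ⟨hcr, hcS⟩
  have hsub : firstComponent S ⊆ S :=
    (firstComponent_subset S).trans (Finset.erase_subset _ _)
  have hlt := hS.lt c hcS
  have hconn : IsConnected (firstComponent S) := isConnected_component (root_mem h2)
  have hroot : root (S.erase (root S)) ∈ firstComponent S := mem_component_self (root_mem h2)
  have hdist : ∀ e ∈ firstComponent S, ¬ Crosses e c ∧ e.left < e.right ∧ e.left ≠ c.left ∧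
      e.left ≠ c.right ∧ e.right ≠ c.left ∧ e.right ≠ c.right := by
    intro e he
    have hne : e ≠ c := fun h => hc1 (h ▸ he)
    exact ⟨not_crosses_component he hce hc1, hS.lt e (hsub he),
      mt (hS.left_inj e (hsub he) c hcS) hne, hS.left_ne_right e (hsub he) c hcS,
      (hS.left_ne_right c hcS e (hsub he)).symm, mt (hS.right_inj e (hsub he) c hcS) hne⟩
  -- No endpoint of the component lies inside `c`. Its root starts before `c` and does not cross
  -- `c`, so it has no endpoint there. A chord with exactly one endpoint inside would cross `c`, and
  -- one with both inside cannot cross a chord with none.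
  have key : ∀ e ∈ firstComponent S, (e.left < c.left ∨ c.right < e.left) ∧
      (e.right < c.left ∨ c.right < e.right) := by
    intro e he
    refine (hconn.2 _ hroot e he).induction (P := fun e =>
      (e.left < c.left ∨ c.right < e.left) ∧ (e.right < c.left ∨ c.right < e.right)) ?_ ?_
    · have h1 := hdist _ hroot
      have h3 := left_root_le hce
      unfold Crosses at h1
      omega
    · intro d hd d' hd' hx hP
      have h1 := hdist d hd
      have h3 := hdist d' hd'
      unfold Crosses at h1 h3 hx
      omega
  obtain ⟨e, he, hep⟩ := mem_endpoints.1 hp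
  have := key e he
  omega

variable (hc : IsConnected S) (h2 : S.erase (root S) ≠ ∅)
include hc h2

/-- All endpoints outside of the first component, except for the first one, lie in the same gap
of the first component. -/
theorem lt_iff_lt_right_root {q : ℕ} (hq : q ∈ endpoints (S \ firstComponent S)) (hq1 : q ≠ 1)
    {p : ℕ} (hp : p ∈ endpoints (firstComponent S)) : p < q ↔ p < (root S).right := by
  have hr : root S ∈ S \ firstComponent S :=
    Finset.mem_sdiff.2 ⟨root_mem hc.1, root_notMem_firstComponent S⟩
  have hr1 := hS.left_root hc.1
  have hgap : ∀ c ∈ S \ firstComponent S, c ≠ root S → (p < c.left ↔ p < c.right) :=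
    fun c hcS hcr => lt_left_iff_lt_right_of_mem_firstComponent hS h2
      (Finset.mem_sdiff.1 hcS).1 (Finset.mem_sdiff.1 hcS).2 hcr hp
  have hp1 : p ≠ 1 := by
    rintro rfl
    exact Finset.disjoint_left.1 (hS.disjoint_endpoints Finset.sdiff_subset
      ((firstComponent_subset S).trans (Finset.erase_subset _ _)) Finset.sdiff_disjoint)
      (hr1 ▸ left_mem_endpoints hr) hp
  have hp0 : 1 < p := by
    have := hS.mem_endpoints_iff.1 (endpoints_mono
      ((firstComponent_subset S).trans (Finset.erase_subset _ _)) hp)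
    omega
  -- The two endpoints of a chord other than the root lie on the same side of `p`, and crossing
  -- chords interleave, so the side is passed on along crossings. For the root only the second
  -- endpoint counts, since its first endpoint `1` is always below `p`.
  have key : ∀ c ∈ S \ firstComponent S, (p < (root S).right ↔ p < c.right) := by
    intro c hcS
    refine (hc.sdiff_firstComponent.2 _ hr c hcS).induction
      (P := fun c => p < (root S).right ↔ p < c.right) Iff.rfl ?_
    intro d hd d' hd' hx hP
    rw [hP]
    have h5 := hS.one_le_left (Finset.mem_sdiff.1 hd).1
    have h6 := hS.one_le_left (Finset.mem_sdiff.1 hd').1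
    have h3 := hS.lt _ (root_mem hc.1)
    by_cases hdr : d = root S <;> by_cases hdr' : d' = root S
    · rw [hdr, hdr']
    · have h1 := hgap d' hd' hdr'
      subst hdr
      unfold Crosses at hx
      omega
    · have h1 := hgap d hd hdr
      subst hdr'
      unfold Crosses at hx
      omega
    · have h1 := hgap d' hd' hdr'
      have h4 := hgap d hd hdr
      unfold Crosses at hx
      omega
  obtain ⟨c, hcS, hcq⟩ := mem_endpoints.1 hq
  have h1 := key c hcS
  by_cases hcr : c = root S
  · subst hcr
    have : q = (root S).right := by omega
    rw [this]
  · have h3 := hgap c hcS hcr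
    rcases hcq with rfl | rfl
    · rw [h3, h1]
    · exact h1.symm

/-- The position is the number of endpoints of the first component that precede the second endpoint
`y` of the root. Apart from `1`, all other endpoints sit in the gap of the first component around
`y`, so the ranks within the two parts differ from the true positions exactly by the shifts in
`outer` and `shift`. -/
theorem exists_insertion : ∃ k, 1 ≤ k ∧ k ≤ 2 * (firstComponent S).card - 1 ∧
    (∀ c ∈ S \ firstComponent S,
      relabel (outer k) (relabel (rank (S \ firstComponent S)) c) = c) ∧
    ∀ c ∈ firstComponent S, relabel (shift (S \ firstComponent S).card k)
      (relabel (rank (firstComponent S)) c) = c := by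
  have hsub : firstComponent S ⊆ S :=
    (firstComponent_subset S).trans (Finset.erase_subset _ _)
  have hr : root S ∈ S \ firstComponent S :=
    Finset.mem_sdiff.2 ⟨root_mem hc.1, root_notMem_firstComponent S⟩
  have hr1 := hS.left_root hc.1
  have h1r : 1 ∈ endpoints (S \ firstComponent S) := hr1 ▸ left_mem_endpoints hr
  have hyr := right_mem_endpoints hr
  have hlt := hS.lt _ (root_mem hc.1)
  have hdis := hS.disjoint_endpoints (A := firstComponent S) (B := S \ firstComponent S) hsub
    Finset.sdiff_subset Finset.disjoint_sdiff
  have hne : ∀ p ∈ endpoints (firstComponent S), ∀ q ∈ endpoints (S \ firstComponent S),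
      p ≠ q := fun p hp q hq he => Finset.disjoint_left.1 hdis hp (he ▸ hq)
  have hpos : ∀ p ∈ endpoints S, 1 ≤ p := fun p hp => (hS.mem_endpoints_iff.1 hp).1
  -- A position in a diagram is its own rank, and the rank is the sum of the ranks in the two parts;
  -- knowing one of these gives the other.
  have hsum : ∀ x ∈ endpoints S,
      rank (firstComponent S) x + rank (S \ firstComponent S) x = x := fun x hx => by
    rw [← rank_of_disjoint_union (Finset.union_sdiff_of_subset hsub) hdis, hS.rank_eq hx]
  have hgap := fun q hq hq1 p hp => lt_iff_lt_right_root hS hc h2 (q := q) hq hq1 (p := p) hp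
  have hm1 := (hS.toIsMatching.mono hsub).card_endpoints
  have hm2 := (hS.toIsMatching.mono (Finset.sdiff_subset (t := firstComponent S))).card_endpoints
  set y := (root S).right with hy
  set E := (endpoints (firstComponent S)).filter (· < y) with hE
  -- This chord has an endpoint on either side of `y`, which yields both bounds on the position.
  obtain ⟨d, hd, hx⟩ := hc.exists_crosses_root (root_mem h2)
  change d ∈ firstComponent S at hd
  have hdl := left_mem_endpoints hd
  have hdr := right_mem_endpoints hd
  have hdpos := hpos _ (endpoints_mono hsub hdl)
  have hd1 := hne _ hdl _ h1r
  have hdlt := hS.lt d (hsub hd)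
  have hxy : d.left < y ∧ y < d.right := by
    unfold Crosses at hx
    omega
  have hshift : ∀ p ∈ endpoints (firstComponent S),
      shift (S \ firstComponent S).card E.card (rank (firstComponent S) p) = p := by
    intro p hp
    have hs := hsum p (endpoints_mono hsub hp)
    have hpy := hne p hp y hyr
    have hp1 := hne p hp 1 h1r
    have hp0 := hpos p (endpoints_mono hsub hp)
    by_cases hlt' : p < y
    · have e1 : rank (S \ firstComponent S) p = 1 := by
        rw [rank, Finset.card_eq_one]
        refine ⟨1, ?_⟩
        ext q
        rw [Finset.mem_filter, Finset.mem_singleton]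
        constructor
        · rintro ⟨hq, hqp⟩
          by_contra hq1
          have := (hgap q hq hq1 p hp).2 hlt'
          omega
        · rintro rfl
          exact ⟨h1r, hp0⟩
      have e2 : rank (firstComponent S) p ≤ E.card :=
        Finset.card_le_card (Finset.monotone_filter_right _ fun z _ hz => lt_of_le_of_lt hz hlt')
      rw [shift, if_pos e2]
      omega
    · have e1 : rank (S \ firstComponent S) p = 2 * (S \ firstComponent S).card := by
        rw [rank, Finset.filter_true_of_mem, hm2]
        intro q hq
        by_cases hq1 : q = 1
        · omega
        · have := (hgap q hq hq1 p hp).not.2 hlt'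
          omega
      have e2 : E.card < rank (firstComponent S) p := by
        refine Finset.card_lt_card (Finset.ssubset_iff_of_subset ?_ |>.2 ⟨p, ?_, ?_⟩)
        · exact Finset.monotone_filter_right _ fun z _ hz => by omega
        · exact Finset.mem_filter.2 ⟨hp, le_rfl⟩
        · exact fun h => hlt' (Finset.mem_filter.1 h).2
      rw [shift, if_neg (not_le.2 e2)]
      omega
  have houter : ∀ q ∈ endpoints (S \ firstComponent S),
      outer E.card (rank (S \ firstComponent S) q) = q := by
    intro q hq
    have hqS := endpoints_mono Finset.sdiff_subset hq
    have hs := hsum q hqS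
    have hq0 : 0 < rank (S \ firstComponent S) q :=
      Finset.card_pos.2 ⟨q, Finset.mem_filter.2 ⟨hq, le_rfl⟩⟩
    by_cases hq1 : q = 1
    · unfold outer
      split_ifs <;> omega
    · have e1 : rank (firstComponent S) q = E.card := by
        rw [rank, hE]
        congr 1
        refine Finset.filter_congr fun p hp => ?_
        rw [← hgap q hq hq1 p hp]
        exact ⟨fun h => lt_of_le_of_ne h (hne p hp q hq), le_of_lt⟩
      have e2 : 1 < rank (S \ firstComponent S) q := by
        refine Finset.one_lt_card.2 ⟨1, ?_, q, ?_, Ne.symm hq1⟩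
        · exact Finset.mem_filter.2 ⟨h1r, hpos q hqS⟩
        · exact Finset.mem_filter.2 ⟨hq, le_rfl⟩
      rw [outer, if_neg (not_le.2 e2)]
      omega
  refine ⟨E.card, ?_, ?_, ?_, ?_⟩
  · exact Finset.card_pos.2 ⟨d.left, Finset.mem_filter.2 ⟨hdl, hxy.1⟩⟩
  · have : E.card < (endpoints (firstComponent S)).card :=
      Finset.card_lt_card (Finset.ssubset_iff_of_subset (Finset.filter_subset _ _) |>.2
        ⟨d.right, hdr, fun h => absurd (Finset.mem_filter.1 h).2 (by omega)⟩)
    omega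
  · exact fun c hc => Chord.ext_iff.2
      ⟨houter _ (left_mem_endpoints hc), houter _ (right_mem_endpoints hc)⟩
  · exact fun c hc => Chord.ext_iff.2
      ⟨hshift _ (left_mem_endpoints hc), hshift _ (right_mem_endpoints hc)⟩

end Decomposition

/-! ### Weights of plane trees -/

namespace PlaneTree

variable {α β : Type}

/-- Relabelling the leaves of a tree. -/
def map (f : α → β) : PlaneTree α → PlaneTree β
  | leaf a => leaf (f a)
  | node l r => node (l.map f) (r.map f)

@[simp] theorem numEdges_map (f : α → β) (T : PlaneTree α) : (T.map f).numEdges = T.numEdges := by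
  induction T with
  | leaf => rfl
  | node l r hl hr => simp [map, numEdges, hl, hr]

@[simp] theorem leaves_map (f : α → β) (T : PlaneTree α) : (T.map f).leaves = T.leaves.map f := by
  induction T with
  | leaf => rfl
  | node l r hl hr => simp [map, leaves, hl, hr]

theorem map_map {γ : Type} (g : β → γ) (f : α → β) (T : PlaneTree α) :
    (T.map f).map g = T.map (g ∘ f) := by
  induction T with
  | leaf => rfl
  | node l r hl hr => simp [map, hl, hr]

theorem map_congr {f g : α → β} {T : PlaneTree α} (h : ∀ x ∈ T.leaves, f x = g x) :
    T.map f = T.map g := by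
  induction T with
  | leaf x => simp [map, h x (by simp [leaves])]
  | node l r hl hr =>
    rw [map, map, hl fun x hx => h x (by simp [leaves, hx]),
      hr fun x hx => h x (by simp [leaves, hx])]

theorem map_insert (f : α → β) (T' T : PlaneTree α) (k : ℕ) :
    (insert T' k T).map f = insert (T'.map f) k (T.map f) := by
  induction T generalizing k with
  | leaf => rfl
  | node l r hl hr =>
    simp only [insert, map, numEdges_map]
    split_ifs <;> simp [map, hl, hr]

theorem leaves_insert_perm (T' T : PlaneTree α) (k : ℕ) :
    (insert T' k T).leaves.Perm (T'.leaves ++ T.leaves) := by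
  induction T generalizing k with
  | leaf => rfl
  | node l r hl hr =>
    simp only [insert]
    split_ifs
    · rfl
    · simpa [leaves] using (hl (k - 1)).append_right r.leaves
    · refine ((hr (k - 1 - l.numEdges)).append_left l.leaves).trans ?_
      simp only [leaves, ← List.append_assoc]
      exact List.perm_append_comm.append_right _

theorem length_leaves_pos (T : PlaneTree α) : 0 < T.leaves.length := by
  induction T with
  | leaf => simp [leaves]
  | node l r hl hr => simp [leaves]; omega

theorem numEdges_eq (T : PlaneTree α) : T.numEdges = 2 * T.leaves.length - 1 := by
  induction T with
  | leaf => rfl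
  | node l r hl hr =>
    have h1 := l.length_leaves_pos
    have h2 := r.length_leaves_pos
    simp only [numEdges, leaves, List.length_append]
    omega

variable {R : Type*} [CommRing R]

/-- The product of `χ x ν` over the leaves `x`, with `ν` the branch-left number of `x` if `m` edges
going up and to the left can be followed in succession from the root. -/
def weight (χ : α → ℕ → R) : ℕ → PlaneTree α → R
  | m, leaf x => χ x m
  | m, node l r => weight χ 0 l * weight χ (m + 1) r

theorem weight_map (χ : β → ℕ → R) (f : α → β) (m : ℕ) (T : PlaneTree α) :
    weight χ m (T.map f) = weight (χ ∘ f) m T := by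
  induction T generalizing m with
  | leaf => rfl
  | node l r hl hr => simp [map, weight, hl, hr]

/-- Labels must be distinct because `branchLeftAux` locates a leaf by testing whether its label
occurs in the left subtree. -/
theorem prod_branchLeftAux [DecidableEq α] (χ : α → ℕ → R) (m : ℕ) {T : PlaneTree α}
    (h : T.leaves.Nodup) :
    (T.leaves.map fun x => χ x (branchLeftAux x m T)).prod = weight χ m T := by
  induction T generalizing m with
  | leaf x => simp [weight, leaves, branchLeftAux]
  | node l r hl hr =>
    simp only [leaves, List.nodup_append] at h
    obtain ⟨h1, h2, h3⟩ := h
    simp only [leaves, List.map_append, List.prod_append, weight]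
    rw [← hl 0 h1, ← hr (m + 1) h2]
    congr 2
    · refine List.map_congr_left fun x hx => ?_
      rw [branchLeftAux, if_pos hx]
    · refine List.map_congr_left fun x hx => ?_
      rw [branchLeftAux, if_neg fun hx' => h3 x hx' x hx rfl]

/-- Insertion at any of the `ν + 1` edges of the chain of a leaf replaces `χ x ν` by `χ x (ν + 1)`,
and the chains partition the edges. To make the induction work, `m` further edges are imagined above
the root, continuing the chain of the rightmost leaf; insertion at each of them would give `weight χ
0 T' * weight χ (m + 1) T`, which accounts for the second term on the left. -/
theorem sum_weight_insert {χ : α → ℕ → R} {u : α → R}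
    (hχ : ∀ x (m : ℕ), ((m : R) + 1) * χ x (m + 1) = (u x + m - 1) * χ x m) (T' T : PlaneTree α)
    (m : ℕ) :
    (∑ j ∈ Finset.range T.numEdges, weight χ m (insert T' (j + 1) T)) +
        m * (weight χ 0 T' * weight χ (m + 1) T) =
      weight χ 0 T' * weight χ m T * ((T.leaves.map u).sum + m - 1) := by
  induction T generalizing m with
  | leaf x =>
    simp only [numEdges, Finset.sum_range_one, insert, weight, leaves, List.map_cons, List.map_nil,
      List.sum_cons, List.sum_nil, add_zero]
    linear_combination weight χ 0 T' * hχ x m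
  | node l r hl hr =>
    have hl := hl 0
    have hr := hr (m + 1)
    have e1 : ∀ j ∈ Finset.range l.numEdges, weight χ m (insert T' (1 + j + 1) (node l r)) =
        weight χ 0 (insert T' (j + 1) l) * weight χ (m + 1) r := by
      intro j hj
      rw [Finset.mem_range] at hj
      rw [insert, if_neg (by omega), if_pos (by omega), weight, show 1 + j + 1 - 1 = j + 1 by omega]
    have e2 : ∀ j ∈ Finset.range r.numEdges,
        weight χ m (insert T' (1 + l.numEdges + j + 1) (node l r)) =
        weight χ 0 l * weight χ (m + 1) (insert T' (j + 1) r) := by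
      intro j _
      rw [insert, if_neg (by omega), if_neg (by omega), weight,
        show 1 + l.numEdges + j + 1 - 1 - l.numEdges = j + 1 by omega]
    -- In pre-order the edges are the virtual edge, those of `l` and those of `r`; the edges above
    -- the two subtrees play the role of their virtual edges.
    rw [numEdges, Finset.sum_range_add, Finset.sum_range_add, Finset.sum_congr rfl e1,
      Finset.sum_congr rfl e2, ← Finset.sum_mul, ← Finset.mul_sum]
    simp only [Finset.sum_range_one, insert, zero_add, le_refl, if_true, weight, leaves,
      List.map_append, List.sum_append]
    push_cast at hl hr ⊢
    -- The hypothesis for `r` at `m + 1` contains `m + 1` insertions above the root: one is the term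
    -- of the virtual edge, the other `m` are the extra term on the left.
    linear_combination weight χ (m + 1) r * hl + weight χ 0 l * hr

end PlaneTree

/-! ### The insertion tree -/

theorem insertionTree_of_erase_eq_empty {S : Finset Chord} (h : S.erase (root S) = ∅) :
    insertionTree S = .leaf (root S) := by
  rw [insertionTree, dif_pos h]

theorem insertionTree_of_erase_ne_empty {S : Finset Chord} (h : S.erase (root S) ≠ ∅) :
    insertionTree S = (insertionTree (S \ firstComponent S)).insert (insertionIndex S)
      (insertionTree (firstComponent S)) := by
  rw [insertionTree, dif_neg h]

theorem card_firstComponent_lt {S : Finset Chord} (h : S ≠ ∅) :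
    (firstComponent S).card < S.card :=
  (Finset.card_le_card (firstComponent_subset S)).trans_lt
    (Finset.card_erase_lt_of_mem (root_mem h))

theorem card_sdiff_firstComponent_lt {S : Finset Chord} (h : S.erase (root S) ≠ ∅) :
    (S \ firstComponent S).card < S.card :=
  Finset.card_lt_card (Finset.sdiff_ssubset
    ((firstComponent_subset S).trans (Finset.erase_subset _ _)) (firstComponent_nonempty h))

theorem sdiff_firstComponent_ne_empty {S : Finset Chord} (h : S ≠ ∅) :
    S \ firstComponent S ≠ ∅ :=
  Finset.ne_empty_of_mem (Finset.mem_sdiff.2 ⟨root_mem h, root_notMem_firstComponent S⟩)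

theorem firstComponent_relabel {f : ℕ → ℕ} {S : Finset Chord} (hf : StrictMonoOn f (endpoints S))
    (h : S.erase (root S) ≠ ∅) :
    firstComponent (S.image (relabel f)) = (firstComponent S).image (relabel f) := by
  have hS : S ≠ ∅ := fun h' => h (by rw [h']; rfl)
  have hf' := strictMonoOn_endpoints_subset hf (Finset.erase_subset (root S) S)
  rw [firstComponent, root_relabel hf hS, ← image_relabel_erase hf (root_mem hS),
    root_relabel hf' h, component_relabel hf' (root_mem h), firstComponent]

/-- The equation that defines the index involves `S` and its parts only through their
normalizations. -/
theorem insertionIndex_relabel {f : ℕ → ℕ} {S : Finset Chord} (hf : StrictMonoOn f (endpoints S))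
    (h : S.erase (root S) ≠ ∅) :
    insertionIndex (S.image (relabel f)) = insertionIndex S := by
  have hsub := (firstComponent_subset S).trans (Finset.erase_subset _ _)
  rw [insertionIndex, firstComponent_relabel hf h, ← image_relabel_sdiff hf hsub, norm_relabel hf,
    norm_relabel (strictMonoOn_endpoints_subset hf hsub),
    norm_relabel (strictMonoOn_endpoints_subset hf Finset.sdiff_subset),
    Finset.card_image_of_injOn (relabel_injOn (strictMonoOn_endpoints_subset hf hsub)),
    insertionIndex]

theorem insertionTree_relabel {f : ℕ → ℕ} {S : Finset Chord} (hf : StrictMonoOn f (endpoints S))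
    (hS : S ≠ ∅) : insertionTree (S.image (relabel f)) = (insertionTree S).map (relabel f) := by
  induction hn : S.card using Nat.strong_induction_on generalizing S with
  | _ n ih =>
    subst hn
    have h' : (S.image (relabel f)).erase (root (S.image (relabel f))) =
        (S.erase (root S)).image (relabel f) := by
      rw [root_relabel hf hS, image_relabel_erase hf (root_mem hS)]
    by_cases h : S.erase (root S) = ∅
    · rw [insertionTree_of_erase_eq_empty h, insertionTree_of_erase_eq_empty (by rw [h', h]; rfl),
        root_relabel hf hS]
      rfl
    · have hsub := (firstComponent_subset S).trans (Finset.erase_subset _ _)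
      rw [insertionTree_of_erase_ne_empty h,
        insertionTree_of_erase_ne_empty (by rw [h']; simpa using h), firstComponent_relabel hf h,
        ← image_relabel_sdiff hf hsub, insertionIndex_relabel hf h,
        ih _ (card_sdiff_firstComponent_lt h) (strictMonoOn_endpoints_subset hf Finset.sdiff_subset)
          (sdiff_firstComponent_ne_empty hS) rfl,
        ih _ (card_firstComponent_lt hS) (strictMonoOn_endpoints_subset hf hsub)
          (firstComponent_nonempty h).ne_empty rfl, PlaneTree.map_insert]

theorem leaves_insertionTree_perm {S : Finset Chord} (hS : S ≠ ∅) :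
    (insertionTree S).leaves.Perm S.toList := by
  induction hn : S.card using Nat.strong_induction_on generalizing S with
  | _ n ih =>
    subst hn
    by_cases h : S.erase (root S) = ∅
    · have : S = {root S} := ((Finset.erase_eq_empty_iff _ _).1 h).resolve_left hS
      rw [insertionTree_of_erase_eq_empty h]
      conv_rhs => rw [this]
      simp [PlaneTree.leaves]
    · rw [insertionTree_of_erase_ne_empty h]
      refine (PlaneTree.leaves_insert_perm _ _ _).trans
        (((ih _ (card_sdiff_firstComponent_lt h) (sdiff_firstComponent_ne_empty hS) rfl).append
          (ih _ (card_firstComponent_lt hS) (firstComponent_nonempty h).ne_empty rfl)).trans ?_)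
      refine (List.perm_ext_iff_of_nodup ?_ (Finset.nodup_toList _)).2 fun c => ?_
      · refine List.nodup_append.2 ⟨Finset.nodup_toList _, Finset.nodup_toList _, ?_⟩
        rintro c hc d hd rfl
        rw [Finset.mem_toList] at hc hd
        exact (Finset.mem_sdiff.1 hc).2 hd
      · have : c ∈ firstComponent S → c ∈ S := fun hc =>
          (firstComponent_subset S).trans (Finset.erase_subset _ _) hc
        simp only [List.mem_append, Finset.mem_toList, Finset.mem_sdiff]
        tauto

theorem nodup_leaves_insertionTree {S : Finset Chord} (hS : S ≠ ∅) :
    (insertionTree S).leaves.Nodup :=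
  (leaves_insertionTree_perm hS).nodup_iff.2 (Finset.nodup_toList _)

theorem mem_leaves_insertionTree {S : Finset Chord} (hS : S ≠ ∅) {c : Chord} :
    c ∈ (insertionTree S).leaves ↔ c ∈ S := by
  rw [(leaves_insertionTree_perm hS).mem_iff, Finset.mem_toList]

theorem numEdges_insertionTree {S : Finset Chord} (hS : S ≠ ∅) :
    (insertionTree S).numEdges = 2 * S.card - 1 := by
  rw [PlaneTree.numEdges_eq, (leaves_insertionTree_perm hS).length_eq, Finset.length_toList]

/-! ### Weights along the intersection order -/

section GapWeight

variable {ι R : Type*} [CommRing R]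

/-- The extension of `a d` to the integers by zero. -/
def extendZero (a : ι → ℕ → R) (d : ι) (z : ℤ) : R := if 0 ≤ z then a d z.toNat else 0

/-- The product, over a list of decorated chords that are marked as terminal or not, of `a d 0` for
the chords that are not terminal and of `a d j` for the terminal ones, with `j` the distance to the
previous terminal chord; the first chord of the list has distance `g`. -/
def gapWeight (a : ι → ℕ → R) : ℤ → List (Bool × ι) → R
  | _, [] => 1
  | g, (true, d) :: L => extendZero a d g * gapWeight a 1 L
  | g, (false, d) :: L => a d 0 * gapWeight a (g + 1) L

/-- A terminal chord resets the distance to `1`, so what follows does not see what came before. -/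
theorem gapWeight_append_terminal (a : ι → ℕ → R) (g : ℤ) (L M : List (Bool × ι)) (d : ι) :
    gapWeight a g (L ++ [(true, d)] ++ M) = gapWeight a g (L ++ [(true, d)]) * gapWeight a 1 M := by
  induction L generalizing g with
  | nil => simp [gapWeight]
  | cons p L ih =>
    obtain ⟨b, e⟩ := p
    cases b <;> simp only [List.cons_append, gapWeight, ih, mul_assoc]

/-- The chords of `S` in intersection order, recorded by whether they are terminal and by their
decorations. -/
def orderData (S : Finset Chord) (δ : Chord → ι) : List (Bool × ι) :=
  (intersectionOrder S).map fun c => (decide (Terminal S c), δ c)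

theorem orderData_congr {S : Finset Chord} {δ δ' : Chord → ι} (h : ∀ c ∈ S, δ c = δ' c) :
    orderData S δ = orderData S δ' :=
  List.map_congr_left fun c hc => by rw [h c ((mem_intersectionOrder S c).1 hc)]

/-- The first chord of a connected diagram contributes the same factor to the weight with initial
distance `0` whether or not it is terminal. -/
theorem gapWeight_zero_of_isConnected {C : Finset Chord} (h : IsConnected C) (a : ι → ℕ → R)
    (δ : Chord → ι) : gapWeight a 0 (orderData C δ) = a (δ (root C)) 0 *
      gapWeight a 1 ((intersectionOrder (C.erase (root C))).map fun c =>
        (decide (Terminal C c), δ c)) := by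
  rw [orderData, intersectionOrder_of_isConnected h, List.map_cons]
  by_cases ht : Terminal C (root C)
  · simp [ht, gapWeight, extendZero]
  · simp [ht, gapWeight]

end GapWeight

/-! ### Insertion tree, intersection order and terminal chords of an insertion -/

namespace Insertable

variable {C D : Finset Chord} {k : ℕ} (h : Insertable C k D)
include h

theorem erase_root_ne_empty : (insertion C k D).erase (root (insertion C k D)) ≠ ∅ := by
  rw [h.erase_root_eq]
  exact Finset.ne_empty_of_mem (Finset.mem_union_right _
    (Finset.mem_image_of_mem _ (root_mem h.connected_right.1)))

theorem insertionTree_eq : insertionTree (insertion C k D) =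
    ((insertionTree C).map (relabel (outer k))).insert k
      ((insertionTree D).map (relabel (shift C.card k))) := by
  rw [insertionTree_of_erase_ne_empty h.erase_root_ne_empty, h.sdiff_firstComponent_eq,
    h.firstComponent_eq, h.insertionIndex_eq,
    insertionTree_relabel ((strictMono_outer k).strictMonoOn _) h.connected_left.1,
    insertionTree_relabel (h.strictMono_shift.strictMonoOn _) h.connected_right.1]

/-- Once the root is removed, the copy of `D` is the first component, and what remains is a copy of
`C` without its root. -/
theorem intersectionOrder_eq : intersectionOrder (insertion C k D) =
    relabel (outer k) (root C) :: ((intersectionOrder D).map (relabel (shift C.card k)) ++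
      (intersectionOrder (C.erase (root C))).map (relabel (outer k))) := by
  have h1 : component ((insertion C k D).erase (root (insertion C k D)))
      (root ((insertion C k D).erase (root (insertion C k D)))) = _ := h.firstComponent_eq
  have h2 : (insertion C k D).erase (root (insertion C k D)) \ D.image (relabel (shift C.card k)) =
      (C.erase (root C)).image (relabel (outer k)) := by
    rw [h.erase_root_eq, Finset.union_sdiff_right, Finset.sdiff_eq_self_of_disjoint]
    exact h.disjoint.mono_left (Finset.image_subset_image (Finset.erase_subset _ _))
  rw [intersectionOrder_of_isConnected h.isConnected, intersectionOrder_eq_append, h1, h2,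
    h.root_eq, intersectionOrder_relabel (h.strictMono_shift.strictMonoOn _),
    intersectionOrder_relabel ((strictMono_outer k).strictMonoOn _)]

theorem not_terminal_root : ¬ Terminal (insertion C k D) (root (insertion C k D)) := by
  obtain ⟨d, hd, hx⟩ := h.exists_crosses_root
  rw [← h.root_eq] at hx
  have hd' := h.subset_right (Finset.mem_image_of_mem _ hd)
  refine fun ht => ht _ hd' ?_ hx
  have := left_root_le hd'
  unfold Crosses at hx
  omega

theorem terminal_outer_iff {c : Chord} (hc : c ∈ C) (hr : c ≠ root C) :
    Terminal (insertion C k D) (relabel (outer k) c) ↔ Terminal C c := by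
  rw [← terminal_relabel_iff ((strictMono_outer k).strictMonoOn _) hc]
  refine ⟨fun ht d hd => ht d (h.subset_left hd), fun ht d hd => ?_⟩
  rcases h.mem_insertion.1 hd with hd | hd
  · exact ht d hd
  · obtain ⟨d, -, rfl⟩ := Finset.mem_image.1 hd
    exact fun _ => h.not_crosses hc hr d

/-- The only chord of `C` that can cross a chord of `D` is the root, and its first endpoint is the
smallest. -/
theorem terminal_shift_iff {d : Chord} (hd : d ∈ D) :
    Terminal (insertion C k D) (relabel (shift C.card k) d) ↔ Terminal D d := by
  rw [← terminal_relabel_iff (h.strictMono_shift.strictMonoOn _) hd]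
  refine ⟨fun ht c hc => ht c (h.subset_right hc), fun ht c hc hlt => ?_⟩
  rcases h.mem_insertion.1 hc with hc | hc
  · obtain ⟨c, hcC, rfl⟩ := Finset.mem_image.1 hc
    by_cases hr : c = root C
    · rw [hr, ← h.root_eq] at hlt
      exact absurd (left_root_le (h.subset_right (Finset.mem_image_of_mem _ hd))) (not_le.2 hlt)
    · exact fun hx => h.not_crosses hcC hr d hx.symm
  · exact ht c hc hlt

/-- The root of `C` is not terminal and turns the distance `g` into `g + 1` before `D` is read. The
last chord of `D` is terminal, so the rest of `C` is read from distance `1`; with the factor of the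
root this is the weight of `C` from distance `0`, by `gapWeight_zero_of_isConnected`. -/
theorem gapWeight_eq {ι R : Type*} [CommRing R] (a : ι → ℕ → R) (δ : Chord → ι) (g : ℤ) :
    gapWeight a g (orderData (insertion C k D) δ) =
      gapWeight a 0 (orderData C (δ ∘ relabel (outer k))) *
        gapWeight a (g + 1) (orderData D (δ ∘ relabel (shift C.card k))) := by
  obtain ⟨L, d, hL, hd⟩ := exists_terminal_last h.connected_right.1
  have e1 : orderData (insertion C k D) δ = (false, δ (relabel (outer k) (root C))) ::
      (orderData D (δ ∘ relabel (shift C.card k)) ++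
        (intersectionOrder (C.erase (root C))).map fun c =>
          (decide (Terminal C c), (δ ∘ relabel (outer k)) c)) := by
    rw [orderData, h.intersectionOrder_eq, List.map_cons, List.map_append, List.map_map,
      List.map_map, ← h.root_eq, decide_eq_false h.not_terminal_root]
    congr 2
    · refine List.map_congr_left fun d hd => ?_
      simp only [Function.comp_apply]
      congr 1
      exact decide_eq_decide.2 (h.terminal_shift_iff ((mem_intersectionOrder _ _).1 hd))
    · refine List.map_congr_left fun c hc => ?_
      rw [mem_intersectionOrder, Finset.mem_erase] at hc
      simp only [Function.comp_apply]
      congr 1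
      exact decide_eq_decide.2 (h.terminal_outer_iff hc.2 hc.1)
  have e2 : orderData D (δ ∘ relabel (shift C.card k)) = L.map (fun c =>
      (decide (Terminal D c), (δ ∘ relabel (shift C.card k)) c)) ++
        [(true, (δ ∘ relabel (shift C.card k)) d)] := by
    rw [orderData, hL, List.map_append, List.map_singleton, decide_eq_true hd]
  rw [e1, gapWeight_zero_of_isConnected h.connected_left, gapWeight, e2, gapWeight_append_terminal]
  simp only [Function.comp_apply]
  ring

end Insertable

/-! ### The weight of a diagram -/

section ChordWeight

variable {R : Type*} [CommRing R] [BinomialRing R]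

/-- The factor that a chord with decoration `d` and branch-left number `m` contributes. -/
def chooseWeight (s : R) (d : ℕ+) (m : ℕ) : R := Ring.choose ((d : ℕ) * s + (m : R) - 2) m

/-- The absorption identity `n * choose r n = r * choose (r - 1) (n - 1)` with `n = m + 1`. The sum
over insertion positions uses no other property of the binomial coefficients. -/
theorem chooseWeight_succ (s : R) (d : ℕ+) (m : ℕ) :
    ((m : R) + 1) * chooseWeight s d (m + 1) =
      ((d : ℕ) * s + m - 1) * chooseWeight s d m := by
  have := Ring.choose_smul_choose ((d : ℕ) * s + ((m + 1 : ℕ) : R) - 2) (n := m + 1) (k := 1)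
    (by omega)
  rw [Nat.choose_one_right, Ring.choose_one_right, nsmul_eq_mul, Nat.add_sub_cancel] at this
  push_cast at this
  unfold chooseWeight
  push_cast
  rw [this, show (d : ℕ) * s + ((m : R) + 1) - 2 - 1 = (d : ℕ) * s + m - 2 by ring]
  ring

/-- The product of `chooseWeight` over the leaves of the insertion tree. -/
def insertionWeight (s : R) (S : Finset Chord) (δ : Chord → ℕ+) : R :=
  ((insertionTree S).map δ).weight (chooseWeight s) 0

theorem map_insertionTree_congr {S : Finset Chord} (hS : S ≠ ∅) {δ δ' : Chord → ℕ+}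
    (h : ∀ c ∈ S, δ c = δ' c) : (insertionTree S).map δ = (insertionTree S).map δ' :=
  PlaneTree.map_congr fun c hc => h c ((mem_leaves_insertionTree hS).1 hc)

theorem insertionWeight_eq_prod (s : R) {S : Finset Chord} (hS : S ≠ ∅) (δ : Chord → ℕ+) :
    insertionWeight s S δ =
      ∏ c ∈ S, chooseWeight s (δ c) ((insertionTree S).branchLeft c) := by
  rw [insertionWeight, PlaneTree.weight_map,
    ← PlaneTree.prod_branchLeftAux _ _ (nodup_leaves_insertionTree hS),
    ((leaves_insertionTree_perm hS).map _).prod_eq, Finset.prod_map_toList]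
  rfl

/-- The sum of the weights over all insertions of `C` into `D`. -/
theorem sum_insertionWeight (s : R) {C D : Finset Chord} (hD : D ≠ ∅)
    {δ δ' : Chord → ℕ+} {ε : ℕ → Chord → ℕ+}
    (hins : ∀ j ∈ Finset.range (2 * D.card - 1), Insertable C (j + 1) D)
    (hε : ∀ j ∈ Finset.range (2 * D.card - 1), ∀ c ∈ C, ε j (relabel (outer (j + 1)) c) = δ c)
    (hε' : ∀ j ∈ Finset.range (2 * D.card - 1), ∀ d ∈ D,
      ε j (relabel (shift C.card (j + 1)) d) = δ' d) :
    ∑ j ∈ Finset.range (2 * D.card - 1), insertionWeight s (insertion C (j + 1) D) (ε j) =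
      (s * (∑ d ∈ D, (δ' d : ℕ) : ℕ) - 1) * (insertionWeight s C δ * insertionWeight s D δ') := by
  have e : ∀ j ∈ Finset.range (2 * D.card - 1),
      insertionWeight s (insertion C (j + 1) D) (ε j) = PlaneTree.weight (chooseWeight s) 0
        (((insertionTree C).map δ).insert (j + 1) ((insertionTree D).map δ')) := by
    intro j hj
    rw [insertionWeight, (hins j hj).insertionTree_eq, PlaneTree.map_insert, PlaneTree.map_map,
      PlaneTree.map_map, map_insertionTree_congr (δ := ε j ∘ relabel (outer (j + 1)))
        (hins j hj).connected_left.1 (hε j hj),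
      map_insertionTree_congr (δ := ε j ∘ relabel (shift C.card (j + 1))) hD (hε' j hj)]
  -- With `m = 0` the extra term vanishes and the factor becomes the sum of the `d * s`, minus `1`.
  have key := PlaneTree.sum_weight_insert (u := fun d : ℕ+ => ((d : ℕ) : R) * s)
    (chooseWeight_succ s) ((insertionTree C).map δ) ((insertionTree D).map δ') 0
  rw [PlaneTree.numEdges_map, numEdges_insertionTree hD, PlaneTree.leaves_map, List.map_map,
    ((leaves_insertionTree_perm hD).map _).sum_eq, Finset.sum_map_toList] at key
  simp only [Nat.cast_zero, zero_mul, add_zero, Function.comp_apply, ← Finset.sum_mul] at key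
  rw [Finset.sum_congr rfl e, key, insertionWeight, insertionWeight, Nat.cast_sum]
  ring

end ChordWeight

/-! ### Diagrams as sets of chords -/

theorem ChordDiagram.mem_chords {n : ℕ} {C : ChordDiagram n} {c : Chord} :
    c ∈ C.chords ↔ ∃ i : Fin (2 * n), i < C.1 i ∧ c = mkChord (i + 1) (C.1 i + 1) := by
  simp only [ChordDiagram.chords, Finset.mem_image, Finset.mem_filter, Finset.mem_univ, true_and,
    eq_comm]

theorem ChordDiagram.mem_endpoints_chords {n : ℕ} (C : ChordDiagram n) {x : ℕ} :
    x ∈ endpoints C.chords ↔ ∃ i : Fin (2 * n), x = i + 1 := by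
  rw [mem_endpoints]
  constructor
  · rintro ⟨c, hc, hx⟩
    obtain ⟨i, _, rfl⟩ := mem_chords.1 hc
    rcases hx with rfl | rfl
    exacts [⟨i, rfl⟩, ⟨C.1 i, rfl⟩]
  · rintro ⟨i, rfl⟩
    rcases lt_or_gt_of_ne (C.2.2 i) with h | h
    · exact ⟨_, mem_chords.2 ⟨C.1 i, by rwa [C.2.1], rfl⟩, .inr (by simp [C.2.1])⟩
    · exact ⟨_, mem_chords.2 ⟨i, h, rfl⟩, .inl rfl⟩

theorem ChordDiagram.isDiagram {n : ℕ} (C : ChordDiagram n) : IsDiagram C.chords where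
  lt c hc := by
    obtain ⟨i, hi, rfl⟩ := mem_chords.1 hc
    simpa using hi
  left_inj c hc c' hc' he := by
    obtain ⟨i, hi, rfl⟩ := mem_chords.1 hc
    obtain ⟨j, hj, rfl⟩ := mem_chords.1 hc'
    rw [left_mkChord, left_mkChord] at he
    rw [show i = j from Fin.ext (by omega)]
  right_inj c hc c' hc' he := by
    obtain ⟨i, hi, rfl⟩ := mem_chords.1 hc
    obtain ⟨j, hj, rfl⟩ := mem_chords.1 hc'
    rw [right_mkChord, right_mkChord] at he
    rw [show i = j from C.1.injective (Fin.ext (by omega))]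
  left_ne_right c hc c' hc' he := by
    obtain ⟨i, hi, rfl⟩ := mem_chords.1 hc
    obtain ⟨j, hj, rfl⟩ := mem_chords.1 hc'
    rw [left_mkChord, right_mkChord] at he
    have hij : i = C.1 j := Fin.ext (by omega)
    rw [hij, C.2.1] at hi
    exact lt_asymm hi hj
  endpoints_eq := by
    ext x
    rw [C.mem_endpoints_chords, card_chords, Finset.mem_Icc]
    constructor
    · rintro ⟨i, rfl⟩
      omega
    · rintro ⟨h1, h2⟩
      exact ⟨⟨x - 1, by omega⟩, by simp only; omega⟩

theorem ChordDiagram.chords_injective {n : ℕ} :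
    Function.Injective (ChordDiagram.chords (n := n)) := by
  have key : ∀ {C C' : ChordDiagram n}, C.chords = C'.chords → ∀ i, i < C.1 i → C.1 i = C'.1 i := by
    intro C C' h i hi
    obtain ⟨j, _, hj⟩ := mem_chords.1 (h ▸ mem_chords.2 ⟨i, hi, rfl⟩)
    rw [Chord.ext_iff] at hj
    simp only [left_mkChord, right_mkChord] at hj
    have hij : i = j := Fin.ext (by omega)
    subst hij
    exact Fin.ext (by omega)
  intro C C' h
  refine Subtype.ext (Equiv.ext fun i => ?_)
  rcases lt_or_gt_of_ne (C.2.2 i) with hi | hi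
  · have := key h (C.1 i) (by rwa [C.2.1])
    rw [C.2.1] at this
    exact C'.1.injective (by rw [C'.2.1, ← this])
  · exact key h i hi

/-- Each point lies on exactly one chord, and sending it to the other endpoint of that chord is the
required involution. -/
theorem IsDiagram.exists_chordDiagram {S : Finset Chord} (h : IsDiagram S) :
    ∃ C : ChordDiagram S.card, C.chords = S := by
  have hex : ∀ i : Fin (2 * S.card), ∃ j : Fin (2 * S.card),
      mkChord (i + 1) (j + 1) ∈ S ∨ mkChord (j + 1) (i + 1) ∈ S := by
    intro i
    obtain ⟨c, hc, hci⟩ := mem_endpoints.1 (h.mem_endpoints_iff (x := i + 1) |>.2 (by omega))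
    have h1 := h.one_le_left hc
    have h2 := h.right_le hc
    have h3 := h.lt c hc
    rcases hci with hci | hci
    · refine ⟨⟨c.right - 1, by omega⟩, .inl ?_⟩
      convert hc
      rw [Chord.ext_iff]
      simp only [left_mkChord, right_mkChord]
      omega
    · refine ⟨⟨c.left - 1, by omega⟩, .inr ?_⟩
      convert hc
      rw [Chord.ext_iff]
      simp only [left_mkChord, right_mkChord]
      omega
  choose σ hσ using hex
  have huniq : ∀ i j : Fin (2 * S.card),
      mkChord (i + 1) (j + 1) ∈ S ∨ mkChord (j + 1) (i + 1) ∈ S → σ i = j := by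
    intro i j hj
    have aux : ∀ {x y z : ℕ}, (mkChord x y ∈ S ∨ mkChord y x ∈ S) →
        (mkChord x z ∈ S ∨ mkChord z x ∈ S) → y = z := by
      rintro x y z (h1 | h1) (h2 | h2)
      · exact (Chord.ext_iff.1 (h.left_inj _ h1 _ h2 rfl)).2
      · exact absurd rfl (h.left_ne_right _ h1 _ h2)
      · exact absurd rfl (h.left_ne_right _ h2 _ h1)
      · exact (Chord.ext_iff.1 (h.right_inj _ h1 _ h2 rfl)).1
    have := aux (hσ i) hj
    exact Fin.ext (by omega)
  have hinv : Function.Involutive σ := fun i => huniq _ _ (hσ i).symm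
  have hne : ∀ i, σ i ≠ i := by
    intro i hi
    have := hσ i
    rw [hi, or_self] at this
    exact lt_irrefl _ (h.lt _ this)
  refine ⟨⟨hinv.toPerm, hinv, hne⟩, ?_⟩
  ext c
  rw [ChordDiagram.mem_chords]
  constructor
  · rintro ⟨i, hi, rfl⟩
    refine (hσ i).resolve_right fun h' => ?_
    have := h.lt _ h'
    simp only [left_mkChord, right_mkChord] at this
    change i < σ i at hi
    omega
  · intro hc
    have h1 := h.one_le_left hc
    have h2 := h.right_le hc
    have h3 := h.lt c hc
    have h4 := huniq ⟨c.left - 1, by omega⟩ ⟨c.right - 1, by omega⟩ (.inl (by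
      convert hc
      rw [Chord.ext_iff]
      simp only [left_mkChord, right_mkChord]
      omega))
    refine ⟨⟨c.left - 1, by omega⟩, ?_, ?_⟩
    · change _ < σ _
      rw [h4, Fin.mk_lt_mk]
      omega
    · change c = mkChord _ ((σ _ : ℕ) + 1)
      rw [h4, Chord.ext_iff]
      simp only [left_mkChord, right_mkChord]
      omega

/-! ### Decorated diagrams and their weights -/

namespace DecDiagram

variable {D : Set ℕ+}

/-- The decorations as a function on all chords; it is `1` outside of the diagram. -/
def decoration (C : DecDiagram D) (c : Chord) : ℕ+ :=
  if h : c ∈ C.diagram.chords then C.dec ⟨c, h⟩ else 1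

theorem decoration_coe (C : DecDiagram D) (c : C.Chords) : C.decoration c = C.d c :=
  dif_pos c.2

theorem decoration_mem (C : DecDiagram D) {c : Chord} (hc : c ∈ C.diagram.chords) :
    C.decoration c ∈ D := by
  rw [decoration, dif_pos hc]
  exact (C.dec ⟨c, hc⟩).2

/-- Decorations are compared as functions on all chords, since the type of `dec` depends on the
diagram. -/
theorem ext_of_chords {C C' : DecDiagram D} (h : C.diagram.chords = C'.diagram.chords)
    (h' : ∀ c ∈ C.diagram.chords, C.decoration c = C'.decoration c) : C = C' := by
  have hsize : C.size = C'.size := by rw [← card_chords C.diagram, h, card_chords]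
  obtain ⟨n, σ, hσ, δ⟩ := C
  obtain ⟨n', σ', hσ', δ'⟩ := C'
  obtain rfl : n = n' := hsize
  obtain rfl : σ = σ' := ChordDiagram.chords_injective h
  congr 1
  funext c
  have := h' c c.2
  rw [decoration, decoration, dif_pos c.2, dif_pos c.2] at this
  exact Subtype.ext this

theorem isConnected (C : DecDiagram D) : IsConnected C.diagram.chords :=
  isConnected_iff.1 C.connected

theorem exists_of_isDiagram {S : Finset Chord} (hS : IsDiagram S) (hc : IsConnected S)
    (δ : Chord → ℕ+) (hδ : ∀ c ∈ S, δ c ∈ D) :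
    ∃ C : DecDiagram D, C.diagram.chords = S ∧ ∀ c ∈ S, C.decoration c = δ c := by
  obtain ⟨C, hC⟩ := hS.exists_chordDiagram
  refine ⟨⟨S.card, C, isConnected_iff.2 (hC.symm ▸ hc), fun c =>
    ⟨δ c, hδ c (hC.le c.2)⟩⟩, hC, ?_⟩
  intro c hc
  rw [decoration, dif_pos (hC.symm ▸ hc)]

theorem weightSum_eq (C : DecDiagram D) :
    C.weightSum = ∑ c ∈ C.diagram.chords, (C.decoration c : ℕ) := by
  rw [weightSum, ← Finset.sum_coe_sort _ fun c => (C.decoration c : ℕ)]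
  exact Finset.sum_congr rfl fun c _ => by rw [decoration_coe]

variable {R : Type*} [CommRing R]

theorem omega_eq [BinomialRing R] (s : R) (C : DecDiagram D) :
    C.omega s = insertionWeight s C.diagram.chords C.decoration := by
  rw [insertionWeight_eq_prod s C.isConnected.1, omega, ← Finset.prod_coe_sort _ fun c =>
    chooseWeight s (C.decoration c) ((insertionTree C.diagram.chords).branchLeft c)]
  exact Finset.prod_congr rfl fun c _ => by rw [decoration_coe]; rfl

theorem base_mem (C : DecDiagram D) : C.base ∈ C.ter :=
  (Finset.exists_min_image C.ter C.label C.ter_nonempty).choose_spec.1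

theorem label_base_le (C : DecDiagram D) {c : C.Chords} (hc : c ∈ C.ter) :
    C.label C.base ≤ C.label c :=
  (Finset.exists_min_image C.ter C.label C.ter_nonempty).choose_spec.2 c hc

theorem label_injective (C : DecDiagram D) : Function.Injective C.label := by
  intro c c' h
  have hc := (mem_intersectionOrder C.diagram.chords c).2 c.2
  exact Subtype.ext ((List.idxOf_inj hc).1 (Nat.succ_injective h))

theorem mem_ter {C : DecDiagram D} {c : C.Chords} :
    c ∈ C.ter ↔ Terminal C.diagram.chords c := by
  rw [ter, Finset.mem_filter, IsTerminal]
  exact ⟨fun h c' hc' => h.2 ⟨c', hc'⟩, fun h => ⟨Finset.mem_univ _, fun c' => h c' c'.2⟩⟩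

/-- The factor of a chord in `aHat`, completed by the factor `a_{d(b), b - k}` of the base chord. -/
noncomputable def factor (a : ℕ+ → ℕ → R) (k : ℕ) (C : DecDiagram D) (c : C.Chords) : R :=
  if c ∈ C.ter then
    if c = C.base then extendZero a (C.d c) ((C.label c : ℤ) - k)
    else a (C.d c) (C.label c - C.prevTerminal c)
  else a (C.d c) 0

theorem prod_factor (a : ℕ+ → ℕ → R) (k : ℕ) (C : DecDiagram D) :
    ∏ c, C.factor a k c = C.aHat a * extendZero a (C.d C.base) ((C.b : ℤ) - k) := by
  rw [← Finset.prod_mul_prod_compl C.ter, ← Finset.mul_prod_erase _ _ C.base_mem, aHat]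
  have h1 : C.factor a k C.base = extendZero a (C.d C.base) ((C.b : ℤ) - k) := by
    rw [factor, if_pos C.base_mem, if_pos rfl, b]
  have h2 : ∀ c ∈ C.ter.erase C.base,
      C.factor a k c = a (C.d c) (C.label c - C.prevTerminal c) := fun c hc => by
    rw [factor, if_pos (Finset.mem_of_mem_erase hc), if_neg (Finset.ne_of_mem_erase hc)]
  have h3 : ∀ c ∈ C.terᶜ, C.factor a k c = a (C.d c) 0 := fun c hc => by
    rw [factor, if_neg (Finset.mem_compl.1 hc)]
  rw [h1, Finset.prod_congr rfl h2, Finset.prod_congr rfl h3]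
  ring

/-- The distance from a position to the previous terminal chord, or to position `k` if there is
none. -/
def gap (C : DecDiagram D) (k n : ℕ) : ℤ :=
  if C.ter.filter (fun c => C.label c < n) = ∅ then (n : ℤ) - k
  else (n : ℤ) - ((C.ter.filter fun c => C.label c < n).sup C.label : ℕ)

theorem gap_succ_of_notMem (C : DecDiagram D) (k : ℕ) {c : C.Chords} (hc : c ∉ C.ter) :
    C.gap k (C.label c + 1) = C.gap k (C.label c) + 1 := by
  have : C.ter.filter (fun c' => C.label c' < C.label c + 1) =
      C.ter.filter fun c' => C.label c' < C.label c := by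
    refine Finset.filter_congr fun c' hc' => ?_
    have : C.label c' ≠ C.label c := fun h => hc (C.label_injective h ▸ hc')
    omega
  rw [gap, gap, this]
  split_ifs <;> push_cast <;> ring

theorem gap_succ_of_mem (C : DecDiagram D) (k : ℕ) {c : C.Chords} (hc : c ∈ C.ter) :
    C.gap k (C.label c + 1) = 1 := by
  have hmem : c ∈ C.ter.filter fun c' => C.label c' < C.label c + 1 :=
    Finset.mem_filter.2 ⟨hc, by omega⟩
  have : (C.ter.filter fun c' => C.label c' < C.label c + 1).sup C.label = C.label c :=
    le_antisymm (Finset.sup_le fun c' hc' => Nat.lt_succ_iff.1 (Finset.mem_filter.1 hc').2)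
      (Finset.le_sup (f := C.label) hmem)
  rw [gap, if_neg (Finset.ne_empty_of_mem hmem), this]
  push_cast
  ring

/-- The base chord is the only terminal chord without a terminal predecessor, so the case
distinctions in `factor` and `gap` agree. -/
theorem factor_of_mem (a : ℕ+ → ℕ → R) (k : ℕ) (C : DecDiagram D) {c : C.Chords}
    (hc : c ∈ C.ter) : C.factor a k c = extendZero a (C.d c) (C.gap k (C.label c)) := by
  rw [factor, if_pos hc, gap]
  by_cases hb : c = C.base
  · rw [if_pos hb, if_pos]
    refine Finset.filter_eq_empty_iff.2 fun c' hc' => not_lt.2 ?_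
    rw [hb]
    exact C.label_base_le hc'
  · have hlt : C.label C.base < C.label c :=
      lt_of_le_of_ne (C.label_base_le hc) fun h => hb (C.label_injective h).symm
    rw [if_neg hb, if_neg (Finset.ne_empty_of_mem (Finset.mem_filter.2 ⟨C.base_mem, hlt⟩)),
      prevTerminal]
    have : (C.ter.filter fun c' => C.label c' < C.label c).sup C.label ≤ C.label c :=
      Finset.sup_le fun c' hc' => (Finset.mem_filter.1 hc').2.le
    rw [extendZero, if_pos (by omega)]
    congr 1
    omega

/-- The part `P` already read matters only through the distance with which `Q` is reached. As the
order has no repetitions, `P.length + 1` is the label of the first chord of `Q`. -/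
theorem gapWeight_suffix (a : ℕ+ → ℕ → R) (k : ℕ) (C : DecDiagram D) (Q : List C.Chords)
    (P : List Chord) (h : intersectionOrder C.diagram.chords = P ++ Q.map Subtype.val) :
    gapWeight a (C.gap k (P.length + 1))
      (Q.map fun c : C.Chords => (decide (Terminal C.diagram.chords c), C.decoration c)) =
      (Q.map (C.factor a k)).prod := by
  induction Q generalizing P with
  | nil => rfl
  | cons c Q ih =>
    have hnd := nodup_intersectionOrder C.diagram.chords
    have hl : C.label c = P.length + 1 := by
      rw [h, List.nodup_append] at hnd
      have : c.1 ∉ P := fun hP => hnd.2.2 _ hP c.1 (by simp) rfl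
      rw [label, h, List.idxOf_append, if_neg this]
      simp
    have ih := ih (P ++ [c.1]) (by rw [h]; simp)
    rw [List.length_append, List.length_singleton, ← hl] at ih
    rw [List.map_cons, List.map_cons, List.prod_cons, ← ih, decoration_coe, ← hl]
    by_cases hc : c ∈ C.ter
    · rw [decide_eq_true (mem_ter.1 hc), gapWeight, C.gap_succ_of_mem k hc, factor_of_mem a k C hc]
    · rw [decide_eq_false (mt mem_ter.2 hc), gapWeight, C.gap_succ_of_notMem k hc, factor,
        if_neg hc]

/-- Starting at `1 - k`, the distance at the base chord is `b(C) - k`. If this is negative,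
`extendZero` makes the product vanish, which encodes the condition `k ≤ b(C)`. -/
theorem gapWeight_eq (a : ℕ+ → ℕ → R) (k : ℕ) (C : DecDiagram D) :
    gapWeight a (1 - k) (orderData C.diagram.chords C.decoration) =
      C.aHat a * extendZero a (C.d C.base) ((C.b : ℤ) - k) := by
  have hmem : ∀ c ∈ intersectionOrder C.diagram.chords, c ∈ C.diagram.chords := fun c hc =>
    (mem_intersectionOrder _ c).1 hc
  have hval : ((intersectionOrder C.diagram.chords).attachWith _ hmem).map Subtype.val =
      intersectionOrder C.diagram.chords := List.attachWith_map_subtype_val _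
  -- Labels start at `1`, so no terminal chord precedes position `1`.
  have h0 : C.gap k ([] : List Chord).length.succ = 1 - k := by
    rw [gap, if_pos]
    · simp
    · exact Finset.filter_eq_empty_iff.2 fun c _ => by simp [label]
  have key := C.gapWeight_suffix a k _ [] hval.symm
  rw [← C.prod_factor a k, ← h0, orderData]
  conv_lhs => rw [← hval]
  rw [List.map_map]
  refine key.trans ?_
  rw [← List.prod_toFinset]
  · refine Finset.prod_congr ?_ fun _ _ => rfl
    ext c
    simp [mem_intersectionOrder]
  · exact List.Nodup.of_map _ (hval.symm ▸ nodup_intersectionOrder _)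

end DecDiagram

/-! ### Insertion of decorated diagrams -/

theorem relabel_injective {f : ℕ → ℕ} (hf : Function.Injective f) :
    Function.Injective (relabel f) := fun _ _ h =>
  Chord.ext_iff.2 ⟨hf (Chord.ext_iff.1 h).1, hf (Chord.ext_iff.1 h).2⟩

namespace DecDiagram

variable {D : Set ℕ+}

theorem insertable (C C' : DecDiagram D) {j : ℕ}
    (hj : j ∈ Finset.range (2 * C'.diagram.chords.card - 1)) :
    Insertable C.diagram.chords (j + 1) C'.diagram.chords where
  diagram_left := C.diagram.isDiagram
  diagram_right := C'.diagram.isDiagram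
  connected_left := C.isConnected
  connected_right := C'.isConnected
  one_le := by omega
  le := by rw [Finset.mem_range] at hj; omega

/-- The decoration of the chords of the insertion of `C` into `C'` at position `j + 1`. -/
noncomputable def insertionDecoration (C C' : DecDiagram D) (j : ℕ) (c : Chord) : ℕ+ :=
  if c ∈ C.diagram.chords.image (relabel (outer (j + 1))) then
    Function.extend (relabel (outer (j + 1))) C.decoration 1 c
  else Function.extend (relabel (shift C.diagram.chords.card (j + 1))) C'.decoration 1 c

section

variable {C C' : DecDiagram D} {j : ℕ}

theorem insertionDecoration_outer {c : Chord} (hc : c ∈ C.diagram.chords) :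
    C.insertionDecoration C' j (relabel (outer (j + 1)) c) = C.decoration c := by
  rw [insertionDecoration, if_pos (Finset.mem_image_of_mem _ hc),
    (relabel_injective (strictMono_outer _).injective).extend_apply]

theorem insertionDecoration_shift (hj : j ∈ Finset.range (2 * C'.diagram.chords.card - 1))
    {c : Chord} (hc : c ∈ C'.diagram.chords) :
    C.insertionDecoration C' j (relabel (shift C.diagram.chords.card (j + 1)) c) =
      C'.decoration c := by
  have h := C.insertable C' hj
  rw [insertionDecoration, if_neg (Finset.disjoint_right.1 h.disjoint
    (Finset.mem_image_of_mem _ hc)),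
    (relabel_injective h.strictMono_shift.injective).extend_apply]

end

/-- `E` is the insertion of `C` into `C'` at position `j + 1`. -/
structure IsInsertion (C C' : DecDiagram D) (j : ℕ) (E : DecDiagram D) : Prop where
  mem_range : j ∈ Finset.range (2 * C'.diagram.chords.card - 1)
  chords_eq : E.diagram.chords = insertion C.diagram.chords (j + 1) C'.diagram.chords
  decoration_eq : ∀ c ∈ E.diagram.chords, E.decoration c = C.insertionDecoration C' j c

theorem exists_isInsertion (C C' : DecDiagram D) {j : ℕ}
    (hj : j ∈ Finset.range (2 * C'.diagram.chords.card - 1)) : ∃ E, IsInsertion C C' j E := by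
  have h := C.insertable C' hj
  obtain ⟨E, hE, hE'⟩ := exists_of_isDiagram (D := D) h.isDiagram h.isConnected
    (C.insertionDecoration C' j) (by
      intro c hc
      rcases h.mem_insertion.1 hc with hc | hc
      · obtain ⟨d, hd, rfl⟩ := Finset.mem_image.1 hc
        rw [insertionDecoration_outer hd]
        exact C.decoration_mem hd
      · obtain ⟨d, hd, rfl⟩ := Finset.mem_image.1 hc
        rw [insertionDecoration_shift hj hd]
        exact C'.decoration_mem hd)
  exact ⟨E, hj, hE, by rwa [hE]⟩

namespace IsInsertion

variable {C C' E : DecDiagram D} {j : ℕ} (h : IsInsertion C C' j E)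
include h

theorem insertable : Insertable C.diagram.chords (j + 1) C'.diagram.chords :=
  C.insertable C' h.mem_range

theorem decoration_outer {c : Chord} (hc : c ∈ C.diagram.chords) :
    E.decoration (relabel (outer (j + 1)) c) = C.decoration c := by
  rw [h.decoration_eq _ (h.chords_eq ▸ h.insertable.subset_left (Finset.mem_image_of_mem _ hc)),
    insertionDecoration_outer hc]

theorem decoration_shift {c : Chord} (hc : c ∈ C'.diagram.chords) :
    E.decoration (relabel (shift C.diagram.chords.card (j + 1)) c) = C'.decoration c := by
  rw [h.decoration_eq _ (h.chords_eq ▸ h.insertable.subset_right (Finset.mem_image_of_mem _ hc)),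
    insertionDecoration_shift h.mem_range hc]

theorem weightSum_eq : E.weightSum = C.weightSum + C'.weightSum := by
  rw [DecDiagram.weightSum_eq, DecDiagram.weightSum_eq, DecDiagram.weightSum_eq, h.chords_eq,
    C.diagram.isDiagram.insertion_eq, Finset.sum_union h.insertable.disjoint,
    Finset.sum_image (relabel_injOn ((strictMono_outer _).strictMonoOn _)),
    Finset.sum_image (relabel_injOn (h.insertable.strictMono_shift.strictMonoOn _))]
  congr 1
  · exact Finset.sum_congr rfl fun c hc => by rw [h.decoration_outer hc]
  · exact Finset.sum_congr rfl fun c hc => by rw [h.decoration_shift hc]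

theorem unique {E' : DecDiagram D} (h' : IsInsertion C C' j E') : E = E' :=
  ext_of_chords (h.chords_eq.trans h'.chords_eq.symm) fun c hc => by
    rw [h.decoration_eq c hc, h'.decoration_eq c (h'.chords_eq ▸ h.chords_eq ▸ hc)]

theorem index_eq : j + 1 = insertionIndex E.diagram.chords := by
  rw [h.chords_eq, h.insertable.insertionIndex_eq]

theorem chords_left : C.diagram.chords =
    norm (E.diagram.chords \ firstComponent E.diagram.chords) := by
  rw [h.chords_eq, h.insertable.sdiff_firstComponent_eq,
    norm_relabel ((strictMono_outer _).strictMonoOn _), C.diagram.isDiagram.norm_eq]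

theorem chords_right : C'.diagram.chords = norm (firstComponent E.diagram.chords) := by
  rw [h.chords_eq, h.insertable.firstComponent_eq,
    norm_relabel (h.insertable.strictMono_shift.strictMonoOn _), C'.diagram.isDiagram.norm_eq]

/-- The index and the chords of both parts are functions of `E`, and the decorations of the parts
are those of `E` at the relabelled chords. -/
theorem parts_unique {B B' : DecDiagram D} {i : ℕ} (h' : IsInsertion B B' i E) :
    C = B ∧ C' = B' ∧ j = i := by
  have hij : j = i := Nat.succ_injective (h.index_eq.trans h'.index_eq.symm)
  subst hij
  have h1 := h.chords_left.trans h'.chords_left.symm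
  have h2 := h.chords_right.trans h'.chords_right.symm
  refine ⟨ext_of_chords h1 fun c hc => ?_, ext_of_chords h2 fun c hc => ?_, rfl⟩
  · rw [← h.decoration_outer hc, ← h'.decoration_outer (h1 ▸ hc)]
  · rw [← h.decoration_shift hc, ← h'.decoration_shift (h2 ▸ hc), h1]

end IsInsertion

/-- The parts are the normalizations of the first component and of its complement; their decorations
are pulled back from `E` along `outer` and `shift`, which undo the rank maps. -/
theorem exists_eq_insertion (E : DecDiagram D)
    (hE : E.diagram.chords.erase (root E.diagram.chords) ≠ ∅) :
    ∃ C C' j, IsInsertion C C' j E := by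
  have hS := E.diagram.isDiagram
  set S := E.diagram.chords
  obtain ⟨k, hk1, hk2, ho, hs⟩ := exists_insertion hS E.isConnected hE
  have hsub := (firstComponent_subset S).trans (Finset.erase_subset _ _)
  have hf1 := strictMonoOn_rank (S \ firstComponent S)
  have hf2 := strictMonoOn_rank (firstComponent S)
  obtain ⟨C, hC, hCδ⟩ := exists_of_isDiagram (D := D)
    (hS.toIsMatching.mono Finset.sdiff_subset).isDiagram_norm
    ((isConnected_relabel_iff hf1).2 E.isConnected.sdiff_firstComponent)
    (fun c => E.decoration (relabel (outer k) c)) (Finset.forall_mem_image.2 fun c hc => by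
      change E.decoration (relabel (outer k) (relabel (rank _) c)) ∈ D
      rw [ho c hc]
      exact E.decoration_mem (Finset.sdiff_subset hc))
  obtain ⟨C', hC', hCδ'⟩ := exists_of_isDiagram (D := D)
    (hS.toIsMatching.mono hsub).isDiagram_norm
    ((isConnected_relabel_iff hf2).2 (isConnected_component (root_mem hE)))
    (fun c => E.decoration (relabel (shift (S \ firstComponent S).card k) c))
    (Finset.forall_mem_image.2 fun c hc => by
      change E.decoration (relabel (shift _ k) (relabel (rank _) c)) ∈ D
      rw [hs c hc]
      exact E.decoration_mem (hsub hc))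
  have hcard : C.diagram.chords.card = (S \ firstComponent S).card := by
    rw [hC, norm_eq_image, Finset.card_image_of_injOn (relabel_injOn hf1)]
  have hcard' : C'.diagram.chords.card = (firstComponent S).card := by
    rw [hC', norm_eq_image, Finset.card_image_of_injOn (relabel_injOn hf2)]
  obtain ⟨j, rfl⟩ : ∃ j, k = j + 1 := ⟨k - 1, by omega⟩
  have hj : j ∈ Finset.range (2 * C'.diagram.chords.card - 1) := by
    rw [Finset.mem_range]
    omega
  have e1 : C.diagram.chords.image (relabel (outer (j + 1))) = S \ firstComponent S := by
    rw [hC, norm_eq_image, Finset.image_image]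
    exact (Finset.image_congr ho).trans Finset.image_id
  have e2 : C'.diagram.chords.image (relabel (shift C.diagram.chords.card (j + 1))) =
      firstComponent S := by
    rw [hC', norm_eq_image, Finset.image_image, hcard]
    exact (Finset.image_congr hs).trans Finset.image_id
  refine ⟨C, C', j, hj, ?_, fun c hc => ?_⟩
  · rw [C.diagram.isDiagram.insertion_eq, e1, e2, Finset.sdiff_union_of_subset hsub]
  · by_cases hc1 : c ∈ firstComponent S
    · rw [← e2] at hc1
      obtain ⟨c, hc', rfl⟩ := Finset.mem_image.1 hc1
      rw [insertionDecoration_shift hj hc', hCδ' c (hC' ▸ hc'), hcard]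
    · have hc2 : c ∈ S \ firstComponent S := Finset.mem_sdiff.2 ⟨hc, hc1⟩
      rw [← e1] at hc2
      obtain ⟨c, hc', rfl⟩ := Finset.mem_image.1 hc2
      rw [insertionDecoration_outer hc', hCδ c (hC ▸ hc')]

/-! ### The generating functions -/

variable {R : Type*} [CommRing R] [BinomialRing R]

/-- The contribution of a diagram to the generating function `gComb D s a k`. -/
noncomputable def term (s : R) (a : ℕ+ → ℕ → R) (k : ℕ) (C : DecDiagram D) : R :=
  insertionWeight s C.diagram.chords C.decoration *
    gapWeight a (1 - k) (orderData C.diagram.chords C.decoration)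

/-- The decorated diagrams with total decoration `N`. -/
noncomputable def ofWeight (D : Set ℕ+) (N : ℕ) : Finset (DecDiagram D) :=
  (finite_weightSum_eq D N).toFinset

theorem mem_ofWeight {N : ℕ} {C : DecDiagram D} : C ∈ ofWeight D N ↔ C.weightSum = N := by
  simp [ofWeight]

/-- Diagrams with `b(C) < k` may be included because their terms vanish. -/
theorem coeff_gComb (s : R) (a : ℕ+ → ℕ → R) (k N : ℕ) :
    PowerSeries.coeff N (gComb D s a k) = ∑ C ∈ ofWeight D N, C.term s a k := by
  have hfin : {C : DecDiagram D | C.weightSum = N ∧ k ≤ C.b}.Finite :=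
    (finite_weightSum_eq D N).subset fun C hC => hC.1
  rw [gComb, PowerSeries.coeff_mk]
  refine (finsum_mem_eq_finite_toFinset_sum _ hfin).trans ?_
  refine (Finset.sum_congr rfl fun C hC => ?_).trans (Finset.sum_subset (fun C hC => ?_) ?_)
  · rw [Set.Finite.mem_toFinset] at hC
    have hk : k ≤ C.b := hC.2
    rw [term, ← omega_eq, C.gapWeight_eq a k, extendZero, if_pos (by omega), mul_assoc,
      show ((C.b : ℤ) - k).toNat = C.b - k by omega]
  · rw [Set.Finite.mem_toFinset] at hC
    exact mem_ofWeight.2 hC.1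
  · intro C hC hC'
    rw [Set.Finite.mem_toFinset] at hC'
    have hk : ¬ k ≤ C.b := fun h => hC' ⟨mem_ofWeight.1 hC, h⟩
    rw [term, C.gapWeight_eq a k, extendZero, if_neg (by omega), mul_zero, mul_zero]

/-- A single chord is terminal and is read at the negative distance `1 - k`. -/
theorem term_eq_zero (s : R) (a : ℕ+ → ℕ → R) {k : ℕ} (hk : 2 ≤ k) {C : DecDiagram D}
    (hC : C.diagram.chords.erase (root C.diagram.chords) = ∅) : C.term s a k = 0 := by
  have ht : Terminal C.diagram.chords (root C.diagram.chords) := by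
    intro c hc hlt
    rw [(Finset.erase_eq_empty_iff _ _).1 hC |>.resolve_left C.isConnected.1,
      Finset.mem_singleton] at hc
    exact absurd (hc ▸ hlt) (lt_irrefl _)
  rw [term, orderData, intersectionOrder_of_isConnected C.isConnected, hC, intersectionOrder_empty,
    List.map_singleton, decide_eq_true ht, gapWeight, extendZero, if_neg (by omega), zero_mul,
    mul_zero]

theorem IsInsertion.term_eq {C C' E : DecDiagram D} {j : ℕ} (h : IsInsertion C C' j E) (s : R)
    (a : ℕ+ → ℕ → R) (k : ℕ) : E.term s a k =
      insertionWeight s (insertion C.diagram.chords (j + 1) C'.diagram.chords)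
        (C.insertionDecoration C' j) *
      (gapWeight a 0 (orderData C.diagram.chords C.decoration) *
        gapWeight a (1 - k + 1) (orderData C'.diagram.chords C'.decoration)) := by
  rw [term, insertionWeight, map_insertionTree_congr E.isConnected.1 h.decoration_eq, h.chords_eq,
    h.insertable.gapWeight_eq,
    orderData_congr (δ := E.decoration ∘ relabel (outer (j + 1))) (δ' := C.decoration)
      fun c hc => h.decoration_outer hc,
    orderData_congr (δ := E.decoration ∘ relabel (shift _ (j + 1))) (δ' := C'.decoration)
      fun c hc => h.decoration_shift hc]
  rfl

/-- The distances are those required: `0 = 1 - 1` for `C`, and `1 - k + 1 = 1 - (k - 1)` for `C'`.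
The scalar comes from summing the tree weights over all positions. -/
theorem sum_term_insertion (s : R) (a : ℕ+ → ℕ → R) {k : ℕ} (hk : 2 ≤ k) (C C' : DecDiagram D) :
    ∑ j ∈ Finset.range (2 * C'.diagram.chords.card - 1),
      insertionWeight s (insertion C.diagram.chords (j + 1) C'.diagram.chords)
        (C.insertionDecoration C' j) *
      (gapWeight a 0 (orderData C.diagram.chords C.decoration) *
        gapWeight a (1 - k + 1) (orderData C'.diagram.chords C'.decoration)) =
    C.term s a 1 * ((s * (C'.weightSum : R) - 1) * C'.term s a (k - 1)) := by
  rw [← Finset.sum_mul, sum_insertionWeight s C'.isConnected.1 (fun j hj => C.insertable C' hj)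
    (fun j _ c hc => insertionDecoration_outer hc)
    (fun j hj c hc => insertionDecoration_shift hj hc), term, term, C'.weightSum_eq,
    show (1 : ℤ) - (1 : ℕ) = 0 by norm_num, show (1 : ℤ) - (k - 1 : ℕ) = 1 - k + 1 by omega]
  ring

/-- The right side is expanded over insertion positions and matched term by term with the diagrams
of more than one chord through the bijection `E ↔ (C, C', j)`; total decorations add, whence the
antidiagonal. -/
theorem sum_term (s : R) (a : ℕ+ → ℕ → R) {k : ℕ} (hk : 2 ≤ k) (N : ℕ) :
    ∑ E ∈ ofWeight D N, E.term s a k = ∑ p ∈ Finset.HasAntidiagonal.antidiagonal N,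
      ∑ q ∈ ofWeight D p.1 ×ˢ ofWeight D p.2,
        q.1.term s a 1 * ((s * (q.2.weightSum : R) - 1) * q.2.term s a (k - 1)) := by
  simp only [← sum_term_insertion s a hk]
  rw [← Finset.sum_filter_of_ne (p := fun E : DecDiagram D =>
    E.diagram.chords.erase (root E.diagram.chords) ≠ ∅)
    fun E _ hE he => hE (term_eq_zero s a hk he)]
  simp only [Finset.sum_sigma']
  choose L P j h using fun E : DecDiagram D => exists_eq_insertion E
  refine Finset.sum_bij (fun E hE => ⟨((L E (Finset.mem_filter.1 hE).2).weightSum,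
    (P E (Finset.mem_filter.1 hE).2).weightSum), ⟨(L E (Finset.mem_filter.1 hE).2,
    P E (Finset.mem_filter.1 hE).2), j E (Finset.mem_filter.1 hE).2⟩⟩) ?_ ?_ ?_ ?_
  · intro E hE
    obtain ⟨hE, hE'⟩ := Finset.mem_filter.1 hE
    have := h E hE'
    simp only [Finset.mem_sigma, Finset.HasAntidiagonal.mem_antidiagonal, Finset.mem_product,
      mem_ofWeight, true_and, and_true]
    exact ⟨this.weightSum_eq.symm.trans (mem_ofWeight.1 hE), this.mem_range⟩
  · intro E hE E' hE' he
    have h1 := h E (Finset.mem_filter.1 hE).2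
    have h2 := h E' (Finset.mem_filter.1 hE').2
    have he1 := congrArg (fun t => t.2.1.1) he
    have he2 := congrArg (fun t => t.2.1.2) he
    have he3 := congrArg (fun t => t.2.2) he
    dsimp only at he1 he2 he3
    rw [← he1, ← he2, ← he3] at h2
    exact h1.unique h2
  · rintro ⟨⟨m, n⟩, ⟨⟨C, C'⟩, i⟩⟩ ht
    simp only [Finset.mem_sigma, Finset.HasAntidiagonal.mem_antidiagonal, Finset.mem_product,
      mem_ofWeight] at ht
    obtain ⟨hmn, ⟨rfl, rfl⟩, hi⟩ := ht
    obtain ⟨E, hE⟩ := exists_isInsertion C C' hi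
    have hne : E.diagram.chords.erase (root E.diagram.chords) ≠ ∅ := by
      rw [hE.chords_eq]
      exact hE.insertable.erase_root_ne_empty
    refine ⟨E, Finset.mem_filter.2 ⟨mem_ofWeight.2 (hE.weightSum_eq.trans hmn), hne⟩, ?_⟩
    obtain ⟨h1, h2, h3⟩ := (h E hne).parts_unique hE
    rw [h1, h2, h3]
  · intro E hE
    exact (h E (Finset.mem_filter.1 hE).2).term_eq s a k

end DecDiagram

/-! ### Comparison of coefficients -/

theorem coeff_X_mul_derivative {R : Type*} [CommRing R] (f : PowerSeries R) (n : ℕ) :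
    PowerSeries.coeff n (PowerSeries.X * PowerSeries.derivative R f) =
      n * PowerSeries.coeff n f := by
  cases n with
  | zero => simp
  | succ n =>
    rw [PowerSeries.coeff_succ_X_mul, PowerSeries.coeff_derivative]
    push_cast
    ring

end ChordDSE

theorem mainTheorem2 {R : Type*} [CommRing R] [BinomialRing R] (D : Set ℕ+) (s : R)
    (a : ℕ+ → ℕ → R) (k : ℕ) (hk : 2 ≤ k) :
    ChordDSE.gComb D s a k =
      ChordDSE.gComb D s a 1 *
        (s • (PowerSeries.X * PowerSeries.derivative R (ChordDSE.gComb D s a (k - 1))) -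
          ChordDSE.gComb D s a (k - 1)) := by
  ext N
  rw [ChordDSE.DecDiagram.coeff_gComb, ChordDSE.DecDiagram.sum_term s a hk, PowerSeries.coeff_mul]
  refine Finset.sum_congr rfl fun p _ => ?_
  -- On the coefficient of index `p.2` the differential operator acts as multiplication by `s * p.2
  -- - 1`, and `p.2` is the total decoration of the second diagram.
  rw [map_sub, PowerSeries.coeff_smul, ChordDSE.coeff_X_mul_derivative,
    ChordDSE.DecDiagram.coeff_gComb, ChordDSE.DecDiagram.coeff_gComb, Finset.sum_product,
    Finset.sum_mul, smul_eq_mul, ← mul_assoc, ← sub_one_mul, Finset.mul_sum]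
  refine Finset.sum_congr rfl fun C _ => ?_
  rw [Finset.mul_sum]
  refine Finset.sum_congr rfl fun C' hC' => ?_
  rw [ChordDSE.DecDiagram.mem_ofWeight.1 hC']
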